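/- Let $l\ge 1$ be an integer and let $m$ be an integer with $m+1\equiv 0 \pmod 3$ and $m^2\equiv 1 \pmod{3^l}$. Define groups by generators and relations: \[ G_1=\langle \tau,\lambda,\rho : \tau^{3^l}=\lambda^4=1,\ \lambda^2=\rho^2=(\lambda\rho)^2,\ \tau\lambda\tau^{-1}=\rho,\ \tau\rho\tau^{-1}=\lambda\rho\rangle \] (so $G_1\simeq Q_8\rtimes C_{3^l}$), and let $G_2$ be the group with generators $\tau,\lambda,\rho,\nu$ subject to the relations of $G_1$ together with \[ \lambda^2=\nu^2,\quad \nu\lambda\nu^{-1}=\rho\lambda,\quad \nu\rho\nu^{-1}=\rho^{-1},\quad \nu\tau\nu^{-1}=\tau^m \] (so $G_2$ is an extension of $C_2$ by $G_1$, i.e. $1\to G_1\to G_2\to C_2\to 1$ is exact, and its $2$-Sylow subgroups are generalized quaternion of order $16$). Let $e=\exp(G_2)$ be the exponent of $G_2$, and let $k$ be a field containing a primitive $e$-th root of unity $\zeta_e$ (in particular $\operatorname{char} k\nmid e$). For a finite group $G$ let $G$ act on the rational function field $k(x_g : g\in G)$ by $k$-automorphisms with $g\cdot x_h=x_{gh}$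 for all $g,h\in G$, and let $k(G)=k(x_g:g\in G)^G$ be the fixed field. Then both $k(G_1)$ and $k(G_2)$ are $k$-rational, i.e. purely transcendental over $k$. -/

import Mathlib

noncomputable section

/-- The group `Gal(K/k)` of the rational function field `K = k(x_g : g ∈ G)` receives `G` by
permuting the variables from the left: `g` acts as the `k`-automorphism with `g · x_h = x_{gh}`. -/
def noetherAction (k G : Type*) [Field k] [Group G] :
    G →* (FractionRing (MvPolynomial G k) ≃ₐ[k] FractionRing (MvPolynomial G k)) :=
  (IsFractionRing.fieldEquivOfAlgEquivHom k (FractionRing (MvPolynomial G k))).comp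
    { toFun := fun g => MvPolynomial.renameEquiv k (Equiv.mulLeft g)
      map_one' := by
        apply AlgEquiv.coe_toAlgHom_injective
        ext h
        simp
      map_mul' := fun a b => by
        apply AlgEquiv.coe_toAlgHom_injective
        ext h
        simp [mul_assoc] }

theorem noetherAction_X (k G : Type*) [Field k] [Group G] (g h : G) :
    noetherAction k G g
        (algebraMap (MvPolynomial G k) (FractionRing (MvPolynomial G k)) (MvPolynomial.X h)) =
      algebraMap (MvPolynomial G k) (FractionRing (MvPolynomial G k)) (MvPolynomial.X (g * h)) := by
  simp [noetherAction]

/-- The fixed field `k(G) = k(x_g : g ∈ G)^G`. -/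
def noetherField (k G : Type*) [Field k] [Group G] :
    IntermediateField k (FractionRing (MvPolynomial G k)) :=
  IntermediateField.fixedField (noetherAction k G).range

/-- `K` is `k`-rational, i.e. purely transcendental over `k`: it is generated as a field over `k`
by a set of elements that are algebraically independent over `k`. -/
def IsRationalExtension (k K : Type*) [Field k] [Field K] [Algebra k K] : Prop :=
  ∃ s : Set K, AlgebraicIndependent k ((↑) : s → K) ∧ IntermediateField.adjoin k s = ⊤

/-- The relators expressing
`t ^ 3 ^ l = a ^ 4 = 1`, `a ^ 2 = r ^ 2 = (a r) ^ 2`, `t a t⁻¹ = r`, `t r t⁻¹ = a r`. -/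
def relatorsOne {F : Type*} [Group F] (l : ℕ) (t a r : F) : Set F :=
  {t ^ 3 ^ l, a ^ 4, a ^ 2 * (r ^ 2)⁻¹, r ^ 2 * ((a * r) ^ 2)⁻¹,
    (t * a * t⁻¹) * r⁻¹, (t * r * t⁻¹) * (a * r)⁻¹}

/-- The relators expressing
`a ^ 2 = n ^ 2`, `n a n⁻¹ = r a`, `n r n⁻¹ = r⁻¹`, `n t n⁻¹ = t ^ m`. -/
def relatorsTwo {F : Type*} [Group F] (m : ℤ) (t a r n : F) : Set F :=
  {a ^ 2 * (n ^ 2)⁻¹, (n * a * n⁻¹) * (r * a)⁻¹, (n * r * n⁻¹) * (r⁻¹)⁻¹,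
    (n * t * n⁻¹) * (t ^ m)⁻¹}

/-- The group `G₁ = Q₈ ⋊ C_{3^l}`, presented by generators `τ, λ, ρ` (numbered `0, 1, 2`). -/
abbrev GroupOne (l : ℕ) : Type :=
  PresentedGroup (relatorsOne l (FreeGroup.of (0 : Fin 3)) (FreeGroup.of 1) (FreeGroup.of 2))

/-- The group `G₂`, presented by generators `τ, λ, ρ, ν` (numbered `0, 1, 2, 3`), with the relators
of `G₁` and those describing `ν`. -/
abbrev GroupTwo (l : ℕ) (m : ℤ) : Type :=
  PresentedGroup
    (relatorsOne l (FreeGroup.of (0 : Fin 4)) (FreeGroup.of 1) (FreeGroup.of 2) ∪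
      relatorsTwo m (FreeGroup.of (0 : Fin 4)) (FreeGroup.of 1) (FreeGroup.of 2) (FreeGroup.of 3))

end

/-! The proof combines the no-name lemma with Klein's invariants. Let G act faithfully on a space of
linear forms in the x_g with basis `Y` of length d. Then K = k(x_g) is generated over k(Y) by at
most |G| - d invariants T. If d invariants t in k(Y) satisfy [k(Y) : k(t)] ≤ |G|, then E = k(t, T)
lies in K^G and [K : E] ≤ |G|, so E = K^G by Artin's argument. Since E has transcendence degree |G|
and at most |G| generators, these are algebraically independent. This is
`isRationalExtension_fixedField`; it remains to choose `Y` and t for each group.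

As m - 1 is prime to 3, 3^l divides m + 1, so ν inverts τ. Both 8 and 3^l divide e, so k has
primitive roots ε, ζ of these orders; put n = 3^(l-1) and ω = ζ^n. G₂ acts on forms x, y through the
binary octahedral group (G₁ through the binary tetrahedral group). Modulo Q₈ it acts on forms u, v:
τ by ζ and ζ⁻¹, ν by exchanging them. For G₁ the form u alone suffices.

Let Φ, Ψ be `tetraForm` at ω and ω², and f = `octaForm`. Q₈ fixes all three; τ multiplies Φ, Ψ, f by
ω, ω², 1; ν sends them to -Ψ, -Φ, -f. For G₁ take Φ³/f², ΦΨ/f and uⁿΦ/Ψ: adjoining x/y, y, u costs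
degrees at most 12, 2, n, with product 8·3^l = |G₁|. For G₂ start from (ΦΨ)³/f⁴, over which x/y has
degree at most 24. The function κ = (Φ³ + Ψ³)/f² is τ-invariant and changes sign under ν, so it
turns other functions of that kind into invariants. Then u/v and y cost n and 2, and v costs
nothing: the product is 16·3^l = |G₂|. -/

/-! ### Field-theoretic criteria for rationality -/

open IntermediateField in
theorem algebraicIndependent_of_ncard_le {k K ι : Type*} [Field k] [Field K] [Algebra k K]
    [Finite ι] {X : ι → K} (hX : AlgebraicIndependent k X) {s : Set K} (hs : s.Finite)
    (hcard : s.ncard ≤ Nat.card ι) (halg : Algebra.IsAlgebraic (adjoin k s) K) :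
    AlgebraicIndependent k ((↑) : s → K) := by
  have := hs.to_subtype
  have h1 : Algebra.IsAlgebraic (Algebra.adjoin k (Set.range ((↑) : s → K))) K := by
    rw [Subtype.range_coe]
    exact isAlgebraic_adjoin_iff_top.1 halg
  -- A finite set over which `K` is algebraic, no larger than the transcendence degree, is a
  -- transcendence basis; `X` bounds that degree from below.
  refine (Algebra.IsAlgebraic.isTranscendenceBasis_of_lift_le_trdeg_of_finite k
    ((↑) : s → K) ?_).1
  have h2 := hX.lift_cardinalMk_le_trdeg
  rw [← Nat.cast_card, Cardinal.lift_natCast] at h2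
  rw [← Nat.cast_card, Cardinal.lift_natCast, Cardinal.lift_id, ← Cardinal.lift_le,
    Cardinal.lift_natCast]
  refine le_trans ?_ h2
  exact_mod_cast hcard

open IntermediateField in
theorem isRationalExtension_of_adjoin_eq {k K ι : Type*} [Field k] [Field K] [Algebra k K]
    [Finite ι] {X : ι → K} (hX : AlgebraicIndependent k X) {s : Set K} (hs : s.Finite)
    (hcard : s.ncard ≤ Nat.card ι) {E : IntermediateField k K} (hE : adjoin k s = E)
    (halg : Algebra.IsAlgebraic E K) : IsRationalExtension k E := by
  subst hE
  have hind := algebraicIndependent_of_ncard_le hX hs hcard halg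
  refine ⟨Subtype.val ⁻¹' s, ?_, ?_⟩
  · refine AlgebraicIndependent.of_comp (adjoin k s).val ?_
    refine hind.comp (fun a : (Subtype.val ⁻¹' s : Set (adjoin k s)) => (⟨a.1, a.2⟩ : s)) ?_
    intro a b hab
    exact Subtype.ext (Subtype.ext (congrArg (fun c : s => (c : K)) hab))
  · apply lift_injective
    rw [lift_adjoin, lift_top]
    congr 1
    exact (Set.image_preimage_eq_iff (f := ((↑) : adjoin k s → K))).2
      fun x hx => ⟨⟨x, subset_adjoin k s hx⟩, rfl⟩

open IntermediateField in
theorem relrank_adjoin_singleton_le {k K : Type*} [Field k] [Field K] [Algebra k K]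
    {E F : IntermediateField k K} {z : K} (hEF : F = E ⊔ adjoin k {z}) (p : Polynomial E) {d : ℕ}
    (hp : p ≠ 0) (hd : p.natDegree ≤ d) (hz : p.aeval z = 0) :
    relrank E F ≤ d := by
  subst hEF
  have hint : IsIntegral E z := IsAlgebraic.isIntegral ⟨p, hp, hz⟩
  have h1 : extendScalars (le_sup_left : E ≤ E ⊔ adjoin k {z}) = adjoin E {z} := by
    apply restrictScalars_injective k
    rw [restrictScalars_adjoin_eq_sup]
    rfl
  rw [relrank_eq_rank_of_le le_sup_left, h1]
  have := adjoin.finiteDimensional hint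
  rw [← Module.finrank_eq_rank, adjoin.finrank hint]
  exact_mod_cast (Polynomial.natDegree_le_of_dvd (minpoly.dvd _ _ hz) hp).trans hd

-- `G` embeds in the automorphisms of K over its fixed field, so |G| ≤ [K : K^G] ≤ [K : E] ≤ |G|.
open IntermediateField in
theorem eq_fixedField_of_relrank_le {k K G : Type*} [Field k] [Field K] [Algebra k K] [Group G]
    [Finite G] {σ : G →* (K ≃ₐ[k] K)} (hσ : Function.Injective σ) {E : IntermediateField k K}
    (hE : ∀ x ∈ E, ∀ g, σ g x = x) (hrank : relrank E ⊤ ≤ Nat.card G) :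
    FiniteDimensional E K ∧ E = fixedField σ.range := by
  have hle : E ≤ fixedField σ.range := by
    intro x hx
    rw [mem_fixedField_iff]
    rintro _ ⟨g, rfl⟩
    exact hE x hx g
  rw [relrank_top_right] at hrank
  have hfin : FiniteDimensional E K :=
    Module.rank_lt_aleph0_iff.1 (hrank.trans_lt (Cardinal.natCast_lt_aleph0))
  refine ⟨hfin, eq_of_le_of_finrank_le' hle ?_⟩
  have hfin' : FiniteDimensional (fixedField σ.range) K := by
    let _ : Algebra E (fixedField σ.range) := (inclusion hle).toAlgebra
    have : IsScalarTower E (fixedField σ.range) K := IsScalarTower.of_algebraMap_eq (fun _ => rfl)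
    exact FiniteDimensional.right E _ K
  have h1 : Module.finrank E K ≤ Nat.card G := by
    rw [← Module.finrank_eq_rank] at hrank
    exact_mod_cast hrank
  refine h1.trans ?_
  have h2 : Nat.card G ≤ Nat.card (K ≃ₐ[fixedField σ.range] K) := by
    have hmem : ∀ g, σ g ∈ (fixedField σ.range).fixingSubgroup := by
      intro g
      rw [IntermediateField.mem_fixingSubgroup_iff]
      intro x hx
      exact (mem_fixedField_iff _ _).1 hx _ ⟨g, rfl⟩
    refine Nat.card_le_card_of_injective
      (fun g => (fixedField σ.range).fixingSubgroupEquiv ⟨σ g, hmem g⟩) ?_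
    intro a b hab
    exact hσ (Subtype.ext_iff.1 ((fixedField σ.range).fixingSubgroupEquiv.injective hab))
  rw [Nat.card_eq_fintype_card (α := K ≃ₐ[fixedField σ.range] K)] at h2
  exact h2.trans AlgEquiv.card_le

/-! ### The no-name lemma -/

/-- A permutation module over a field on which the group acts faithfully is spanned by its
invariants. -/
theorem mem_span_sum_of_faithful {k K G : Type*} [Field k] [Field K] [Algebra k K] [Group G]
    [Fintype G] {σ : G →* (K ≃ₐ[k] K)} {X : G → K}
    {L : IntermediateField k K} (hL : ∀ g, ∀ x ∈ L, σ g x ∈ L)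
    (hfaith : ∀ g, (∀ x ∈ L, σ g x = x) → g = 1) (h : G) :
    X h ∈ Submodule.span L (Set.range fun a : L => ∑ g, σ g a * X g) := by
  classical
  let χ : G → L →* K := fun g => ((σ g : K →* K).comp (algebraMap L K : L →* K))
  have hχ : Function.Injective χ := by
    intro a b hab
    rw [← inv_mul_eq_one]
    apply hfaith
    intro x hx
    have := DFunLike.congr_fun hab ⟨x, hx⟩
    have h2 : σ a x = σ b x := this
    simp only [map_mul, map_inv, AlgEquiv.mul_apply, ← h2]
    exact (σ a).symm_apply_apply x
  have hli : LinearIndependent K (fun g => (χ g : L → K)) :=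
    (linearIndependent_monoidHom L K).comp χ hχ
  let e : L → (G → L) := fun a g => ⟨σ g a, hL g a a.2⟩
  -- A nonzero functional vanishing on all vectors (σ_g a)_g would be a linear relation among the
  -- distinct characters `χ g`, contradicting Dedekind.
  have htop : Submodule.span L (Set.range e) = ⊤ := by
    by_contra hne
    obtain ⟨f, hf, hle⟩ := Submodule.exists_le_ker_of_lt_top _ (lt_top_iff_ne_top.2 hne)
    apply hf
    have hz : ∑ g, ((f (Pi.single g 1) : L) : K) • (χ g : L → K) = 0 := by
      funext a
      have h1 : f (e a) = 0 := hle (Submodule.subset_span ⟨a, rfl⟩)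
      rw [← (LinearMap.sum_single_apply (fun _ : G => L) (e a)), map_sum] at h1
      have h2 : ∀ g, f (Pi.single g (e a g)) = e a g * f (Pi.single g 1) := by
        intro g
        rw [← smul_eq_mul, ← map_smul, ← Pi.single_smul, smul_eq_mul, mul_one]
      have h3 := congrArg (fun z : L => (z : K)) h1
      simp only [h2] at h3
      simp only [Finset.sum_apply, Pi.smul_apply, smul_eq_mul, Pi.zero_apply]
      rw [← ZeroMemClass.coe_zero L, ← h3]
      push_cast
      refine Finset.sum_congr rfl fun g _ => ?_
      rw [mul_comm]
      rfl
    have h0 := Fintype.linearIndependent_iff.1 hli _ hz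
    apply LinearMap.pi_ext'
    intro g
    ext
    simpa using h0 g
  let φ : (G → L) →ₗ[L] K := Fintype.linearCombination L X
  have h1 : Pi.single h 1 ∈ Submodule.span L (Set.range e) := htop ▸ Submodule.mem_top
  have h2 := Submodule.mem_map_of_mem (f := φ) h1
  rw [Submodule.map_span, ← Set.range_comp] at h2
  have h3 : φ (Pi.single h 1) = X h := by
    simp [φ, Fintype.linearCombination_apply_single]
  rw [h3] at h2
  convert h2 using 3
  funext a
  simp [φ, e, Fintype.linearCombination_apply, Algebra.smul_def]

theorem exists_linearForms_complement {k K ι : Type*} [Field k] [Field K] [Algebra k K]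
    [Finite ι] {X : ι → K} {d : ℕ} {Y : Fin d → K} (hY : LinearIndependent k Y)
    (hYX : ∀ i, Y i ∈ Submodule.span k (Set.range X)) :
    ∃ S : Set K, S.Finite ∧ S.ncard + d ≤ Nat.card ι ∧
      ∀ i, X i ∈ Submodule.span k (Set.range Y ∪ S) := by
  classical
  have := Fintype.ofFinite ι
  obtain ⟨B, hB, hYB, hspan, hli⟩ :=
    exists_linearIndepOn_id_extension (t := Set.range Y ∪ Set.range X) hY.linearIndepOn_id
      Set.subset_union_left
  have hsub : Set.range ((↑) : B → K) ⊆ Submodule.span k (Set.range X) := by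
    rintro _ ⟨⟨b, hb⟩, rfl⟩
    rcases hB hb with ⟨i, rfl⟩ | h
    · exact hYX i
    · exact Submodule.subset_span h
  have hBfin : B.Finite := Set.Finite.subset ((Set.finite_range Y).union (Set.finite_range X)) hB
  have hcard : B.ncard ≤ Nat.card ι := by
    have := hBfin.fintype
    have h1 := linearIndependent_le_span_aux' _ hli (Set.range X) hsub
    rw [← Nat.card_eq_fintype_card, ← Nat.card_eq_fintype_card] at h1
    exact h1.trans (Finite.card_range_le X)
  have hYc : (Set.range Y).ncard = d := by
    rw [← Nat.card_coe_set_eq, Nat.card_range_of_injective hY.injective, Nat.card_fin]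
  refine ⟨B \ Set.range Y, hBfin.subset Set.sdiff_subset, ?_, ?_⟩
  · have := Set.ncard_sdiff_add_ncard_of_subset hYB hBfin
    omega
  · intro i
    rw [Set.union_sdiff_cancel hYB]
    exact hspan (Or.inr ⟨i, rfl⟩)

/-- `Y` is completed to at most |ι| generators of `K`, and so few generators are algebraically
independent. -/
theorem algebraicIndependent_of_linearForms {k K ι : Type*} [Field k] [Field K] [Algebra k K]
    [Finite ι] {X : ι → K} (hX : AlgebraicIndependent k X)
    (htop : IntermediateField.adjoin k (Set.range X) = ⊤) {d : ℕ} {Y : Fin d → K}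
    (hY : LinearIndependent k Y) (hYX : ∀ i, Y i ∈ Submodule.span k (Set.range X)) :
    AlgebraicIndependent k Y := by
  obtain ⟨S, hS, hcard, hspan⟩ := exists_linearForms_complement hY hYX
  have hgen : IntermediateField.adjoin k (Set.range Y ∪ S) = ⊤ := by
    rw [eq_top_iff, ← htop, IntermediateField.adjoin_le_iff]
    rintro _ ⟨i, rfl⟩
    exact Algebra.span_le_adjoin k _ (hspan i) |> IntermediateField.algebra_adjoin_le_adjoin k _
  have halg : Algebra.IsAlgebraic (IntermediateField.adjoin k (Set.range Y ∪ S)) K := by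
    rw [hgen]
    refine ⟨fun x => ?_⟩
    exact isAlgebraic_algebraMap (⟨x, trivial⟩ : (⊤ : IntermediateField k K))
  have hc : (Set.range Y ∪ S).ncard ≤ Nat.card ι := by
    refine (Set.ncard_union_le _ _).trans ?_
    rw [← Nat.card_coe_set_eq (Set.range Y), Nat.card_range_of_injective hY.injective,
      Nat.card_fin]
    omega
  have hind := algebraicIndependent_of_ncard_le hX ((Set.finite_range Y).union hS) hc halg
  refine hind.comp (fun i => (⟨Y i, Or.inl ⟨i, rfl⟩⟩ : (Set.range Y ∪ S : Set K))) ?_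
  intro a b hab
  exact hY.injective (Subtype.ext_iff.1 hab)

/-- The no-name lemma, as a count of generators. -/
theorem exists_invariant_complement {k K G : Type*} [Field k] [Field K] [Algebra k K] [Group G]
    [Finite G] {σ : G →* (K ≃ₐ[k] K)} {X : G → K} (hσ : ∀ g h, σ g (X h) = X (g * h))
    {d : ℕ} {Y : Fin d → K} (hY : LinearIndependent k Y)
    (hYX : ∀ i, Y i ∈ Submodule.span k (Set.range X))
    (hstab : ∀ g i, σ g (Y i) ∈ IntermediateField.adjoin k (Set.range Y))
    (hfaith : ∀ g, (∀ i, σ g (Y i) = Y i) → g = 1) :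
    ∃ T : Set K, T.Finite ∧ T.ncard + d ≤ Nat.card G ∧ (∀ t ∈ T, ∀ g, σ g t = t) ∧
      ∀ F : IntermediateField k K, Set.range Y ⊆ F → T ⊆ F → ∀ g, X g ∈ F := by
  classical
  have := Fintype.ofFinite G
  obtain ⟨S, hS, hcard, hspan⟩ := exists_linearForms_complement hY hYX
  set L := IntermediateField.adjoin k (Set.range Y) with hLdef
  have hYL : ∀ i, Y i ∈ L := fun i => IntermediateField.subset_adjoin _ _ ⟨i, rfl⟩
  have hL : ∀ g, ∀ x ∈ L, σ g x ∈ L := by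
    intro g
    have : L ≤ L.comap (σ g : K →ₐ[k] K) := by
      rw [hLdef, IntermediateField.adjoin_le_iff]
      rintro _ ⟨i, rfl⟩
      exact hstab g i
    exact fun x hx => this hx
  -- These sums are invariant, since left translation permutes their terms.
  set T₀ : Set K := Set.range fun a : L => ∑ g, σ g a * X g with hT₀
  have hXspan : ∀ g, X g ∈ Submodule.span L (insert 1 S) := by
    intro g
    have h1 : Submodule.span k (Set.range Y ∪ S) ≤
        (Submodule.span L (insert 1 S)).restrictScalars k := by
      rw [Submodule.span_le]
      rintro y (⟨i, rfl⟩ | hy)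
      · have h2 : (⟨Y i, hYL i⟩ : L) • (1 : K) ∈ Submodule.span L (insert 1 S) :=
          Submodule.smul_mem _ _ (Submodule.subset_span (Set.mem_insert _ _))
        rwa [Algebra.smul_def, mul_one] at h2
      · exact Submodule.subset_span (Set.mem_insert_of_mem _ hy)
    exact h1 (hspan g)
  have hT₀span : ∀ t ∈ T₀, t ∈ Submodule.span L (insert 1 S) := by
    rintro _ ⟨a, rfl⟩
    refine Submodule.sum_mem _ fun g _ => ?_
    exact Submodule.smul_mem _ (⟨σ g a, hL g a a.2⟩ : L) (hXspan g)
  -- The basis is made to contain 1. It lies in the span of 1 and `S`, so it has at most |S| + 1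
  -- elements, and discarding 1 leaves at most |S| invariants.
  obtain ⟨b, hb, h1b, hbspan, hbli⟩ :=
    exists_linearIndepOn_id_extension (K := L) (s := {(1 : K)}) (t := insert 1 T₀)
      (LinearIndepOn.singleton' fun r hr => by
        rw [id, Algebra.smul_def, mul_one] at hr
        exact Subtype.ext hr) (by simp)
  have hbsub : Set.range ((↑) : b → K) ⊆ Submodule.span L (insert 1 S) := by
    rintro _ ⟨⟨t, ht⟩, rfl⟩
    rcases hb ht with rfl | h
    · exact Submodule.subset_span (Set.mem_insert _ _)
    · exact hT₀span t h
  have := (hS.insert 1).fintype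
  have hbfin : b.Finite := by
    have := LinearIndependent.finite_of_le_span_finite _ hbli (insert 1 S) hbsub
    exact Set.toFinite b
  have hbcard : b.ncard ≤ S.ncard + 1 := by
    have := hbfin.fintype
    have h1 := linearIndependent_le_span_aux' _ hbli (insert 1 S) hbsub
    rw [← Nat.card_eq_fintype_card, ← Nat.card_eq_fintype_card] at h1
    exact h1.trans (Set.ncard_insert_le _ _)
  refine ⟨b \ {1}, hbfin.subset Set.sdiff_subset, ?_, ?_, ?_⟩
  · have := Set.ncard_sdiff_add_ncard_of_subset h1b hbfin
    rw [Set.ncard_singleton] at this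
    omega
  · rintro t ⟨htb, ht1⟩ h
    rcases hb htb with rfl | ⟨a, rfl⟩
    · exact absurd rfl ht1
    · simp only [map_sum]
      exact Fintype.sum_equiv (Equiv.mulLeft h) _ _ fun g => by simp [hσ]
  · intro F hF hT g
    have hLF : L ≤ F := IntermediateField.adjoin_le_iff.2 hF
    have h1 := mem_span_sum_of_faithful (X := X) hL (fun g hg => hfaith g fun i => hg _ (hYL i)) g
    let F' : Submodule L K :=
      { carrier := F
        add_mem' := F.add_mem
        zero_mem' := F.zero_mem
        smul_mem' := fun a x hx => F.mul_mem (hLF a.2) hx }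
    have h2 : Submodule.span L b ≤ F' := by
      rw [Submodule.span_le]
      intro t ht
      by_cases h : t = 1
      · rw [h]
        exact F.one_mem
      · exact hT ⟨ht, h⟩
    have h3 : Submodule.span L T₀ ≤ F' :=
      Submodule.span_le.2 fun t ht => h2 (hbspan (Or.inr ht))
    exact h3 h1

open IntermediateField in
/-- To show that a fixed field of a regular permutation action is rational it suffices to generate,
up to an extension of small degree, the field of a faithful space of linear forms by as many
invariants as there are linear forms. -/
theorem isRationalExtension_fixedField {k K G : Type*} [Field k] [Field K] [Algebra k K] [Group G]
    [Finite G] {σ : G →* (K ≃ₐ[k] K)} {X : G → K} (hX : AlgebraicIndependent k X)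
    (htop : adjoin k (Set.range X) = ⊤) (hσ : ∀ g h, σ g (X h) = X (g * h))
    {d : ℕ} {Y : Fin d → K} (hY : LinearIndependent k Y)
    (hYX : ∀ i, Y i ∈ Submodule.span k (Set.range X))
    (hstab : ∀ g i, σ g (Y i) ∈ adjoin k (Set.range Y))
    (hfaith : ∀ g, (∀ i, σ g (Y i) = Y i) → g = 1) {t : Fin d → K} (ht : ∀ g i, σ g (t i) = t i)
    (hrank : ∀ E : IntermediateField k K, (∀ i, t i ∈ E) →
      ∃ F, E ≤ F ∧ (∀ i, Y i ∈ F) ∧ relrank E F ≤ Nat.card G) :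
    IsRationalExtension k (fixedField σ.range) := by
  obtain ⟨T, hT, hcard, hinv, hgen⟩ := exists_invariant_complement hσ hY hYX hstab hfaith
  set E := adjoin k (Set.range t ∪ T) with hE
  -- The degree bound is needed over k(t, T), not only over k(t); this is why `hrank` quantifies
  -- over all `E`.
  obtain ⟨F, hEF, hYF, hr⟩ := hrank E fun i => subset_adjoin _ _ (Or.inl ⟨i, rfl⟩)
  have hF : F = ⊤ := by
    rw [eq_top_iff, ← htop, adjoin_le_iff]
    rintro _ ⟨g, rfl⟩
    refine hgen F ?_ ?_ g
    · rintro _ ⟨i, rfl⟩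
      exact hYF i
    · exact fun s hs => hEF (subset_adjoin _ _ (Or.inr hs))
  subst hF
  have hEinv : ∀ x ∈ E, ∀ g, σ g x = x := by
    intro x hx g
    have hle : E ≤ fixedField σ.range := by
      rw [hE, adjoin_le_iff]
      rintro x (⟨i, rfl⟩ | hx) <;> rw [SetLike.mem_coe, mem_fixedField_iff] <;> rintro _ ⟨g, rfl⟩
      · exact ht g i
      · exact hinv x hx g
    exact (mem_fixedField_iff _ _).1 (hle hx) _ ⟨g, rfl⟩
  have hinj : Function.Injective σ := by
    rw [injective_iff_map_eq_one]
    intro g hg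
    apply hfaith
    intro i
    rw [hg]
    rfl
  obtain ⟨hfin, hEq⟩ := eq_fixedField_of_relrank_le hinj hEinv hr
  refine isRationalExtension_of_adjoin_eq hX ((Set.finite_range t).union hT) ?_ hEq ?_
  · refine (Set.ncard_union_le _ _).trans ?_
    have h1 : (Set.range t).ncard ≤ d := by
      rw [← Nat.card_coe_set_eq]
      exact (Finite.card_range_le t).trans (Nat.card_fin d).le
    omega
  · rw [← hEq]
    infer_instance

/-! ### Normal forms in groups satisfying the relations -/

section NormalForm

variable {H : Type*} [Group H]

theorem conj_mem_closure_pair {a r s : H}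
    (ha : s * a * s⁻¹ ∈ Subgroup.closure {a, r}) (hr : s * r * s⁻¹ ∈ Subgroup.closure {a, r})
    {q : H} (hq : q ∈ Subgroup.closure {a, r}) : s * q * s⁻¹ ∈ Subgroup.closure {a, r} := by
  have : Subgroup.closure {a, r} ≤ (Subgroup.closure {a, r}).comap (MulAut.conj s).toMonoidHom := by
    rw [Subgroup.closure_le]
    rintro x (rfl | rfl)
    · exact ha
    · exact hr
  exact this hq

/-- The hypothesis says that conjugation by `a` inverts `r`, so letters `a` can be moved to the
right past powers of `r`. -/
theorem exists_zpow_mul_zpow_of_mem_closure {a r : H} (h : r * a * r = a) {q : H}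
    (hq : q ∈ Subgroup.closure {a, r}) : ∃ j b : ℤ, q = r ^ j * a ^ b := by
  have hconj : a * r * a⁻¹ = r⁻¹ := by
    rw [mul_inv_eq_iff_eq_mul, eq_inv_mul_iff_mul_eq, ← mul_assoc, h]
  have h1 : ∀ j : ℤ, a * r ^ j = r ^ (-j) * a := by
    intro j
    have := conj_zpow (a := a) (b := r) (i := j)
    rw [hconj, inv_zpow, ← zpow_neg] at this
    rw [this, inv_mul_cancel_right]
  have h2 : ∀ j : ℤ, a⁻¹ * r ^ j = r ^ (-j) * a⁻¹ := by
    intro j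
    rw [inv_mul_eq_iff_eq_mul, ← mul_assoc, h1, neg_neg, mul_inv_cancel_right]
  induction hq using Subgroup.closure_induction_left with
  | one => exact ⟨0, 0, by simp⟩
  | mul_left x hx y _ ih =>
    obtain ⟨j, b, rfl⟩ := ih
    rcases hx with rfl | rfl
    · exact ⟨-j, 1 + b, by rw [← mul_assoc, h1, zpow_add, zpow_one, mul_assoc]⟩
    · exact ⟨1 + j, b, by rw [zpow_add, zpow_one, mul_assoc]⟩
  | inv_mul_cancel x hx y _ ih =>
    obtain ⟨j, b, rfl⟩ := ih
    rcases hx with rfl | rfl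
    · exact ⟨-j, -1 + b, by rw [← mul_assoc, h2, zpow_add, zpow_neg_one, mul_assoc]⟩
    · exact ⟨-1 + j, b, by rw [zpow_add, zpow_neg_one, mul_assoc]⟩

/-- The relations of `GroupOne l`, satisfied by elements of a group. -/
structure RelationsOne (l : ℕ) (t a r : H) : Prop where
  pow_t : t ^ 3 ^ l = 1
  pow_a : a ^ 4 = 1
  sq : a ^ 2 = r ^ 2
  sq_mul : r ^ 2 = (a * r) ^ 2
  conj_a : t * a * t⁻¹ = r
  conj_r : t * r * t⁻¹ = a * r

/-- The further relations of `GroupTwo l m`, satisfied by elements of a group. -/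
structure RelationsTwo (m : ℤ) (t a r n : H) : Prop where
  sq : a ^ 2 = n ^ 2
  conj_a : n * a * n⁻¹ = r * a
  conj_r : n * r * n⁻¹ = r⁻¹
  conj_t : n * t * n⁻¹ = t ^ m

theorem forall_relatorsOne {l : ℕ} {t a r : H} :
    (∀ x ∈ relatorsOne l t a r, x = 1) ↔ RelationsOne l t a r := by
  simp only [relatorsOne, Set.mem_insert_iff, Set.mem_singleton_iff, forall_eq_or_imp, forall_eq,
    mul_inv_eq_one]
  exact ⟨fun ⟨h1, h2, h3, h4, h5, h6⟩ => ⟨h1, h2, h3, h4, h5, h6⟩,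
    fun ⟨h1, h2, h3, h4, h5, h6⟩ => ⟨h1, h2, h3, h4, h5, h6⟩⟩

theorem forall_relatorsTwo {m : ℤ} {t a r n : H} :
    (∀ x ∈ relatorsTwo m t a r n, x = 1) ↔ RelationsTwo m t a r n := by
  simp only [relatorsTwo, Set.mem_insert_iff, Set.mem_singleton_iff, forall_eq_or_imp, forall_eq,
    mul_inv_eq_one]
  exact ⟨fun ⟨h1, h2, h3, h4⟩ => ⟨h1, h2, h3, h4⟩, fun ⟨h1, h2, h3, h4⟩ => ⟨h1, h2, h3, h4⟩⟩

theorem map_relatorsOne {H' : Type*} [Group H'] (f : H →* H') (l : ℕ) (t a r : H) :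
    f '' relatorsOne l t a r = relatorsOne l (f t) (f a) (f r) := by
  simp [relatorsOne, Set.image_insert_eq]

theorem map_relatorsTwo {H' : Type*} [Group H'] (f : H →* H') (m : ℤ) (t a r n : H) :
    f '' relatorsTwo m t a r n = relatorsTwo m (f t) (f a) (f r) (f n) := by
  simp [relatorsTwo, Set.image_insert_eq]

namespace RelationsOne

variable {l : ℕ} {t a r : H}

theorem mul_mul (h : RelationsOne l t a r) : r * a * r = a := by
  have h1 : a * a = a * (r * a * r) := by
    rw [← pow_two, h.sq, h.sq_mul, pow_two]
    group
  exact (mul_left_cancel h1).symm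

theorem pow_r (h : RelationsOne l t a r) : r ^ 4 = 1 := by
  rw [show 4 = 2 * 2 from rfl, pow_mul, ← h.sq, ← pow_mul, h.pow_a]

theorem inv_conj_r (h : RelationsOne l t a r) : t⁻¹ * r * t⁻¹⁻¹ = a := by
  rw [← h.conj_a]
  group

theorem inv_conj_a (h : RelationsOne l t a r) : t⁻¹ * a * t⁻¹⁻¹ = r * a⁻¹ := by
  have h1 : a = t * r * t⁻¹ * r⁻¹ := by rw [h.conj_r, mul_inv_cancel_right]
  calc t⁻¹ * a * t⁻¹⁻¹ = t⁻¹ * (t * r * t⁻¹ * r⁻¹) * t⁻¹⁻¹ := by rw [← h1]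
    _ = r * (t⁻¹ * r * t⁻¹⁻¹)⁻¹ := by group
    _ = r * a⁻¹ := by rw [h.inv_conj_r]

theorem commute_sq (h : RelationsOne l t a r) : Commute t (r ^ 2) := by
  have h1 : t * r ^ 2 * t⁻¹ = r ^ 2 := by
    rw [← conj_pow, h.conj_r, h.sq_mul]
  exact mul_inv_eq_iff_eq_mul.1 h1

theorem exists_zpow (h : RelationsOne l t a r) (htop : Subgroup.closure {t, a, r} = ⊤) (g : H) :
    ∃ j b i : ℤ, g = r ^ j * a ^ b * t ^ i := by
  have hr : r ∈ Subgroup.closure {a, r} := Subgroup.subset_closure (by simp)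
  have ha : a ∈ Subgroup.closure {a, r} := Subgroup.subset_closure (by simp)
  -- The subgroup generated by `a` and `r` is stable under conjugation by `t`, so powers of `t`
  -- collect on the right.
  suffices hs : ∃ q ∈ Subgroup.closure {a, r}, ∃ i : ℤ, g = q * t ^ i by
    obtain ⟨q, hq, i, rfl⟩ := hs
    obtain ⟨j, b, rfl⟩ := exists_zpow_mul_zpow_of_mem_closure h.mul_mul hq
    exact ⟨j, b, i, rfl⟩
  have hg : g ∈ Subgroup.closure {t, a, r} := htop ▸ Subgroup.mem_top g
  induction hg using Subgroup.closure_induction_left with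
  | one => exact ⟨1, one_mem _, 0, by simp⟩
  | mul_left x hx y _ ih =>
    obtain ⟨q, hq, i, rfl⟩ := ih
    rcases hx with rfl | hx
    · refine ⟨x * q * x⁻¹, conj_mem_closure_pair ?_ ?_ hq, 1 + i, ?_⟩
      · rwa [h.conj_a]
      · rw [h.conj_r]
        exact mul_mem ha hr
      · rw [zpow_add]
        group
    · exact ⟨x * q, mul_mem (Subgroup.subset_closure hx) hq, i, by rw [mul_assoc]⟩
  | inv_mul_cancel x hx y _ ih =>
    obtain ⟨q, hq, i, rfl⟩ := ih
    rcases hx with rfl | hx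
    · refine ⟨x⁻¹ * q * x⁻¹⁻¹, conj_mem_closure_pair ?_ ?_ hq, -1 + i, ?_⟩
      · rw [h.inv_conj_a]
        exact mul_mem hr (inv_mem ha)
      · rwa [h.inv_conj_r]
      · rw [zpow_add]
        group
    · exact ⟨x⁻¹ * q, mul_mem (inv_mem (Subgroup.subset_closure hx)) hq, i, by rw [mul_assoc]⟩

theorem exists_pow_t (h : RelationsOne l t a r) (i : ℤ) :
    ∃ i' : Fin (3 ^ l), t ^ i = t ^ (i' : ℕ) := by
  have hpos : (0 : ℤ) < (3 ^ l : ℕ) := by positivity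
  refine ⟨⟨(i % (3 ^ l : ℕ)).toNat, ?_⟩, ?_⟩
  · have := Int.emod_lt_of_pos i hpos
    have := Int.emod_nonneg i hpos.ne'
    omega
  · rw [← zpow_natCast, Int.toNat_of_nonneg (Int.emod_nonneg i hpos.ne')]
    conv_lhs => rw [← Int.emod_add_mul_ediv i (3 ^ l : ℕ), zpow_add, zpow_mul, zpow_natCast,
      h.pow_t, one_zpow, mul_one]

theorem exists_pow_r (h : RelationsOne l t a r) (j b : ℤ) :
    ∃ (j' : Fin 4) (b' : Fin 2), r ^ j * a ^ b = r ^ (j' : ℕ) * a ^ (b' : ℕ) := by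
  have h1 : a ^ b = r ^ (2 * (b / 2)) * a ^ (b % 2) := by
    rw [zpow_mul, zpow_ofNat, ← h.sq, ← zpow_ofNat, ← zpow_mul, ← zpow_add, Int.mul_ediv_add_emod]
  have h2 : ∀ j : ℤ, r ^ j = r ^ (j % 4) := by
    intro j
    conv_lhs => rw [← Int.emod_add_mul_ediv j 4, zpow_add, zpow_mul, zpow_ofNat r, h.pow_r,
      one_zpow, mul_one]
  refine ⟨⟨((j + 2 * (b / 2)) % 4).toNat, by omega⟩, ⟨(b % 2).toNat, by omega⟩, ?_⟩
  rw [h1, ← mul_assoc, ← zpow_add, h2, ← zpow_natCast, ← zpow_natCast,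
    Int.toNat_of_nonneg (by omega), Int.toNat_of_nonneg (by omega)]

theorem surjective (h : RelationsOne l t a r) (htop : Subgroup.closure {t, a, r} = ⊤) :
    Function.Surjective fun p : Fin 4 × Fin 2 × Fin (3 ^ l) =>
      r ^ (p.1 : ℕ) * a ^ (p.2.1 : ℕ) * t ^ (p.2.2 : ℕ) := by
  intro g
  obtain ⟨j, b, i, rfl⟩ := h.exists_zpow htop g
  obtain ⟨j', b', h1⟩ := h.exists_pow_r j b
  obtain ⟨i', h2⟩ := h.exists_pow_t i
  exact ⟨(j', b', i'), by rw [h1, h2]⟩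

end RelationsOne

namespace RelationsTwo

variable {l : ℕ} {m : ℤ} {t a r n : H}

theorem inv_conj_r (h' : RelationsTwo m t a r n) : n⁻¹ * r * n⁻¹⁻¹ = r⁻¹ := by
  have h1 : n * r⁻¹ * n⁻¹ = r := by
    rw [← conj_inv, h'.conj_r, inv_inv]
  nth_rewrite 1 [← h1]
  group

theorem inv_conj_a (h' : RelationsTwo m t a r n) : n⁻¹ * a * n⁻¹⁻¹ = r * a := by
  have h1 : n * (r * a) * n⁻¹ = a := by
    rw [← conj_mul, h'.conj_r, h'.conj_a]
    group
  nth_rewrite 1 [← h1]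
  group

theorem conj_zpow_t (h' : RelationsTwo m t a r n) (i : ℤ) : n * t ^ i = t ^ (m * i) * n := by
  rw [zpow_mul, ← h'.conj_t, conj_zpow]
  group

theorem zpow_t (h : RelationsOne l t a r) (hm : (3 ^ l : ℤ) ∣ m + 1) : t ^ m = t⁻¹ := by
  obtain ⟨c, hc⟩ := hm
  rw [eq_inv_iff_mul_eq_one, ← zpow_add_one, hc, zpow_mul]
  have := h.pow_t
  rw [← zpow_natCast] at this
  push_cast at this
  rw [this, one_zpow]

theorem inv_conj_zpow_t (h : RelationsOne l t a r) (h' : RelationsTwo m t a r n)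
    (hm : (3 ^ l : ℤ) ∣ m + 1) (i : ℤ) : n⁻¹ * t ^ i = t ^ (-i) * n⁻¹ := by
  rw [inv_mul_eq_iff_eq_mul, ← mul_assoc, h'.conj_zpow_t, zpow_mul, zpow_t h hm, inv_zpow, zpow_neg,
    inv_inv, mul_inv_cancel_right]

theorem exists_zpow (h : RelationsOne l t a r) (h' : RelationsTwo m t a r n)
    (hm : (3 ^ l : ℤ) ∣ m + 1) (htop : Subgroup.closure {t, a, r, n} = ⊤) (g : H) :
    ∃ j b i c : ℤ, g = r ^ j * a ^ b * t ^ i * n ^ c := by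
  have hr : r ∈ Subgroup.closure {a, r} := Subgroup.subset_closure (by simp)
  have ha : a ∈ Subgroup.closure {a, r} := Subgroup.subset_closure (by simp)
  suffices hs : ∃ q ∈ Subgroup.closure {a, r}, ∃ i c : ℤ, g = q * t ^ i * n ^ c by
    obtain ⟨q, hq, i, c, rfl⟩ := hs
    obtain ⟨j, b, rfl⟩ := exists_zpow_mul_zpow_of_mem_closure h.mul_mul hq
    exact ⟨j, b, i, c, rfl⟩
  have hg : g ∈ Subgroup.closure {t, a, r, n} := htop ▸ Subgroup.mem_top g
  induction hg using Subgroup.closure_induction_left with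
  | one => exact ⟨1, one_mem _, 0, 0, by simp⟩
  | mul_left x hx y _ ih =>
    obtain ⟨q, hq, i, c, rfl⟩ := ih
    have key : ∀ x ∈ Subgroup.closure {a, r}, ∃ q' ∈ Subgroup.closure {a, r}, ∃ i' c' : ℤ,
        x * (q * t ^ i * n ^ c) = q' * t ^ i' * n ^ c' := fun x hx =>
      ⟨x * q, mul_mem hx hq, i, c, by simp only [mul_assoc]⟩
    rcases hx with rfl | rfl | rfl | rfl
    · refine ⟨x * q * x⁻¹, conj_mem_closure_pair ?_ ?_ hq, 1 + i, c, ?_⟩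
      · rwa [h.conj_a]
      · rw [h.conj_r]
        exact mul_mem ha hr
      · rw [zpow_add]
        group
    · exact key _ ha
    · exact key _ hr
    · refine ⟨x * q * x⁻¹, conj_mem_closure_pair ?_ ?_ hq, m * i, 1 + c, ?_⟩
      · rw [h'.conj_a]
        exact mul_mem hr ha
      · rw [h'.conj_r]
        exact inv_mem hr
      · have h1 := h'.conj_zpow_t i
        calc x * (q * t ^ i * x ^ c) = x * q * x⁻¹ * (x * t ^ i) * x ^ c := by group
          _ = _ := by
            rw [h1, zpow_add]
            group
  | inv_mul_cancel x hx y _ ih =>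
    obtain ⟨q, hq, i, c, rfl⟩ := ih
    have key : ∀ x ∈ Subgroup.closure {a, r}, ∃ q' ∈ Subgroup.closure {a, r}, ∃ i' c' : ℤ,
        x⁻¹ * (q * t ^ i * n ^ c) = q' * t ^ i' * n ^ c' := fun x hx =>
      ⟨x⁻¹ * q, mul_mem (inv_mem hx) hq, i, c, by simp only [mul_assoc]⟩
    rcases hx with rfl | rfl | rfl | rfl
    · refine ⟨x⁻¹ * q * x⁻¹⁻¹, conj_mem_closure_pair ?_ ?_ hq, -1 + i, c, ?_⟩
      · rw [h.inv_conj_a]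
        exact mul_mem hr (inv_mem ha)
      · rwa [h.inv_conj_r]
      · rw [zpow_add]
        group
    · exact key _ ha
    · exact key _ hr
    · refine ⟨x⁻¹ * q * x⁻¹⁻¹, conj_mem_closure_pair ?_ ?_ hq, -i, -1 + c, ?_⟩
      · rw [h'.inv_conj_a]
        exact mul_mem hr ha
      · rw [h'.inv_conj_r]
        exact inv_mem hr
      · have h1 := inv_conj_zpow_t h h' hm i
        calc x⁻¹ * (q * t ^ i * x ^ c) = x⁻¹ * q * x⁻¹⁻¹ * (x⁻¹ * t ^ i) * x ^ c := by group
          _ = _ := by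
            rw [h1, zpow_add]
            group

theorem surjective (h : RelationsOne l t a r) (h' : RelationsTwo m t a r n)
    (hm : (3 ^ l : ℤ) ∣ m + 1) (htop : Subgroup.closure {t, a, r, n} = ⊤) :
    Function.Surjective fun p : Fin 4 × Fin 2 × Fin (3 ^ l) × Fin 2 =>
      r ^ (p.1 : ℕ) * a ^ (p.2.1 : ℕ) * t ^ (p.2.2.1 : ℕ) * n ^ (p.2.2.2 : ℕ) := by
  intro g
  obtain ⟨j, b, i, c, rfl⟩ := exists_zpow h h' hm htop g
  -- Since n² = a² = r² commutes with `t` and `a`, the even part of `n ^ c` is absorbed into the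
  -- power of `r`.
  have h1 : n ^ c = r ^ (2 * (c / 2)) * n ^ (c % 2) := by
    rw [zpow_mul, zpow_ofNat r, ← h.sq, h'.sq, ← zpow_ofNat n, ← zpow_mul, ← zpow_add,
      Int.mul_ediv_add_emod]
  have h2 : t ^ i * r ^ (2 * (c / 2)) = r ^ (2 * (c / 2)) * t ^ i := by
    rw [zpow_mul, zpow_ofNat r]
    exact ((h.commute_sq.zpow_left i).zpow_right (c / 2)).eq
  have h3 : a ^ b * r ^ (2 * (c / 2)) = r ^ (2 * (c / 2)) * a ^ b := by
    rw [zpow_mul, zpow_ofNat r, ← h.sq]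
    exact (((Commute.refl a).pow_right 2).zpow_left b |>.zpow_right (c / 2)).eq
  obtain ⟨j', b', h4⟩ := h.exists_pow_r (j + 2 * (c / 2)) b
  obtain ⟨i', h5⟩ := h.exists_pow_t i
  refine ⟨(j', b', i', ⟨(c % 2).toNat, by omega⟩), ?_⟩
  dsimp only
  rw [← h4, ← h5, ← zpow_natCast n, Int.toNat_of_nonneg (by omega), h1, zpow_add]
  calc r ^ j * r ^ (2 * (c / 2)) * a ^ b * t ^ i * n ^ (c % 2)
      = r ^ j * (r ^ (2 * (c / 2)) * a ^ b) * t ^ i * n ^ (c % 2) := by simp only [mul_assoc]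
    _ = r ^ j * a ^ b * (r ^ (2 * (c / 2)) * t ^ i) * n ^ (c % 2) := by
      rw [← h3]
      simp only [mul_assoc]
    _ = _ := by
      rw [← h2]
      simp only [mul_assoc]

end RelationsTwo

end NormalForm

/-! ### Relations in, and homomorphisms from, the presented groups -/

section Presentation

variable {l : ℕ} {m : ℤ}

theorem relationsOne_groupOne (l : ℕ) : RelationsOne l (PresentedGroup.of 0 : GroupOne l)
    (PresentedGroup.of 1) (PresentedGroup.of 2) := by
  rw [← forall_relatorsOne]
  intro x hx
  erw [← map_relatorsOne (PresentedGroup.mk _)] at hx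
  obtain ⟨y, hy, rfl⟩ := hx
  exact PresentedGroup.one_of_mem hy

theorem relationsOne_groupTwo (l : ℕ) (m : ℤ) : RelationsOne l (PresentedGroup.of 0 : GroupTwo l m)
    (PresentedGroup.of 1) (PresentedGroup.of 2) := by
  rw [← forall_relatorsOne]
  intro x hx
  erw [← map_relatorsOne (PresentedGroup.mk _)] at hx
  obtain ⟨y, hy, rfl⟩ := hx
  exact PresentedGroup.one_of_mem (Or.inl hy)

theorem relationsTwo_groupTwo (l : ℕ) (m : ℤ) : RelationsTwo m (PresentedGroup.of 0 : GroupTwo l m)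
    (PresentedGroup.of 1) (PresentedGroup.of 2) (PresentedGroup.of 3) := by
  rw [← forall_relatorsTwo]
  intro x hx
  erw [← map_relatorsTwo (PresentedGroup.mk _)] at hx
  obtain ⟨y, hy, rfl⟩ := hx
  exact PresentedGroup.one_of_mem (Or.inr hy)

/-- The homomorphism out of `GroupOne l` given by elements satisfying its relations. -/
def GroupOne.lift {H : Type*} [Group H] {t a r : H} (h : RelationsOne l t a r) :
    GroupOne l →* H :=
  PresentedGroup.toGroup (f := ![t, a, r]) <| by
    intro x hx
    have h1 := Set.mem_image_of_mem (FreeGroup.lift ![t, a, r]) hx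
    rw [map_relatorsOne] at h1
    exact forall_relatorsOne.2 h _ (by simpa using h1)

/-- The homomorphism out of `GroupTwo l m` given by elements satisfying its relations. -/
def GroupTwo.lift {H : Type*} [Group H] {t a r n : H} (h : RelationsOne l t a r)
    (h' : RelationsTwo m t a r n) : GroupTwo l m →* H :=
  PresentedGroup.toGroup (f := ![t, a, r, n]) <| by
    intro x hx
    have h1 := Set.mem_image_of_mem (FreeGroup.lift ![t, a, r, n]) hx
    rw [Set.image_union, map_relatorsOne, map_relatorsTwo] at h1
    simp only [FreeGroup.lift_apply_of] at h1
    rcases h1 with h1 | h1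
    · exact forall_relatorsOne.2 h _ h1
    · exact forall_relatorsTwo.2 h' _ h1

theorem closure_groupOne (l : ℕ) : Subgroup.closure {(PresentedGroup.of 0 : GroupOne l),
    PresentedGroup.of 1, PresentedGroup.of 2} = ⊤ := by
  rw [← PresentedGroup.closure_range_of]
  congr 1
  ext x
  simp [Fin.exists_fin_succ, eq_comm]

theorem closure_groupTwo (l : ℕ) (m : ℤ) : Subgroup.closure {(PresentedGroup.of 0 : GroupTwo l m),
    PresentedGroup.of 1, PresentedGroup.of 2, PresentedGroup.of 3} = ⊤ := by
  rw [← PresentedGroup.closure_range_of]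
  congr 1
  ext x
  simp [Fin.exists_fin_succ, eq_comm]

end Presentation

/-! ### The octahedral and dihedral representations -/

section Representations

variable {F : Type*} [Field F] {l : ℕ} {m : ℤ}

theorem IsPrimitiveRoot.pow_four_eq_neg_one {ε : F} (hε : IsPrimitiveRoot ε 8) : ε ^ 4 = -1 := by
  have h1 : (ε ^ 4) ^ 2 = 1 := by
    rw [← pow_mul]
    exact hε.pow_eq_one
  exact (sq_eq_one_iff.1 h1).resolve_left
    (hε.pow_ne_one_of_pos_of_lt (by norm_num) (by norm_num))

theorem IsPrimitiveRoot.two_ne_zero_of_eight {ε : F} (hε : IsPrimitiveRoot ε 8) : (2 : F) ≠ 0 := by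
  intro h
  refine hε.pow_ne_one_of_pos_of_lt (l := 4) (by norm_num) (by norm_num) ?_
  rw [hε.pow_four_eq_neg_one]
  linear_combination -h

open Matrix in
theorem relationsOne_quaternion (hl : 1 ≤ l) {i : F} (hi : i ^ 2 = -1) (h2 : (2 : F) ≠ 0)
    {t a r : GL (Fin 2) F}
    (ht : t.val = !![-(1 + i) / 2, (i - 1) / 2; (1 + i) / 2, (i - 1) / 2])
    (ha : a.val = !![0, 1; -1, 0]) (hr : r.val = !![i, 0; 0, -i]) : RelationsOne l t a r := by
  have h2' : (2 : F) * 2⁻¹ = 1 := mul_inv_cancel₀ h2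
  -- Here `t` already has order dividing 3; `1 ≤ l` then gives the relation for `3 ^ l`.
  have ht3 : t ^ 3 = 1 := by
    ext i j
    simp only [pow_succ, pow_zero, one_mul, Units.val_mul, ht, mul_fin_two, Units.val_one,
      one_fin_two]
    fin_cases i <;> fin_cases j <;> simp <;> grind
  refine ⟨?_, ?_, ?_, ?_, ?_, ?_⟩
  · rw [← Nat.sub_add_cancel hl, pow_succ', pow_mul, ht3, one_pow]
  all_goals
    try rw [mul_inv_eq_iff_eq_mul]
    ext i j
    simp only [pow_succ, pow_zero, one_mul, Units.val_mul, ht, ha, hr, mul_fin_two,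
      Units.val_one, one_fin_two]
    fin_cases i <;> fin_cases j <;> simp <;> grind

open Matrix in
theorem relationsTwo_quaternion (hm : (3 ^ l : ℤ) ∣ m + 1) {ε : F} (hε : ε ^ 4 = -1)
    (h2 : (2 : F) ≠ 0) {t a r n : GL (Fin 2) F}
    (ht : t.val = !![-(1 + ε ^ 2) / 2, (ε ^ 2 - 1) / 2; (1 + ε ^ 2) / 2, (ε ^ 2 - 1) / 2])
    (ha : a.val = !![0, 1; -1, 0]) (hr : r.val = !![ε ^ 2, 0; 0, -ε ^ 2])
    (hn : n.val = !![0, ε; ε ^ 3, 0]) (h1 : RelationsOne l t a r) : RelationsTwo m t a r n := by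
  have h2' : (2 : F) * 2⁻¹ = 1 := mul_inv_cancel₀ h2
  refine ⟨?_, ?_, ?_, ?_⟩
  · ext i j
    simp only [pow_two, Units.val_mul, ha, hn, mul_fin_two]
    fin_cases i <;> fin_cases j <;> simp <;> linear_combination -hε
  · rw [mul_inv_eq_iff_eq_mul]
    ext i j
    simp only [Units.val_mul, ha, hr, hn, mul_fin_two]
    fin_cases i <;> fin_cases j <;> simp
    · linear_combination (-ε) * hε
    · ring
  · rw [mul_inv_eq_iff_eq_mul, eq_inv_mul_iff_mul_eq]
    ext i j
    simp only [Units.val_mul, hr, hn, mul_fin_two]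
    fin_cases i <;> fin_cases j <;> simp
    · linear_combination (-ε) * hε
    · linear_combination (-ε ^ 3) * hε
  · rw [RelationsTwo.zpow_t h1 hm, mul_inv_eq_iff_eq_mul, eq_inv_mul_iff_mul_eq]
    ext i j
    simp only [Units.val_mul, ht, hn, mul_fin_two]
    fin_cases i <;> fin_cases j <;> simp <;> field_simp
    · linear_combination (-ε - ε ^ 3) * hε
    · linear_combination (-3 * ε + ε ^ 3) * hε
    · linear_combination (ε - ε ^ 3) * hε
    · linear_combination (-ε + ε ^ 3) * hε

-- The binary octahedral group in SL₂, with `ε ^ 2` as the square root of -1.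
open Matrix in
theorem exists_quaternionRep (hm : (3 ^ l : ℤ) ∣ m + 1) (hl : 1 ≤ l) {ε : F}
    (hε : IsPrimitiveRoot ε 8) :
    ∃ U : GroupTwo l m →* GL (Fin 2) F,
      (U (PresentedGroup.of 0)).val = !![-(1 + ε ^ 2) / 2, (ε ^ 2 - 1) / 2;
        (1 + ε ^ 2) / 2, (ε ^ 2 - 1) / 2] ∧
      (U (PresentedGroup.of 1)).val = !![0, 1; -1, 0] ∧
      (U (PresentedGroup.of 2)).val = !![ε ^ 2, 0; 0, -ε ^ 2] ∧
      (U (PresentedGroup.of 3)).val = !![0, ε; ε ^ 3, 0] := by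
  have h4 := hε.pow_four_eq_neg_one
  have h2 := hε.two_ne_zero_of_eight
  have hε0 : ε ≠ 0 := hε.ne_zero (by norm_num)
  have hdet : (!![-(1 + ε ^ 2) / 2, (ε ^ 2 - 1) / 2;
      (1 + ε ^ 2) / 2, (ε ^ 2 - 1) / 2] : Matrix (Fin 2) (Fin 2) F).det ≠ 0 := by
    have : (!![-(1 + ε ^ 2) / 2, (ε ^ 2 - 1) / 2;
        (1 + ε ^ 2) / 2, (ε ^ 2 - 1) / 2] : Matrix (Fin 2) (Fin 2) F).det = 1 := by
      rw [det_fin_two_of]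
      field_simp
      linear_combination (-2) * h4
    rw [this]
    exact one_ne_zero
  have h1 := relationsOne_quaternion (l := l) hl (i := ε ^ 2) (by rw [← pow_mul]; exact h4) h2
    (t := GeneralLinearGroup.mkOfDetNeZero _ hdet)
    (a := GeneralLinearGroup.mkOfDetNeZero !![0, 1; -1, 0] (by simp))
    (r := GeneralLinearGroup.mkOfDetNeZero !![ε ^ 2, 0; 0, -ε ^ 2] (by simp [hε0])) rfl rfl rfl
  have h2 := relationsTwo_quaternion hm h4 h2
    (n := GeneralLinearGroup.mkOfDetNeZero !![0, ε; ε ^ 3, 0] (by simp [hε0])) rfl rfl rfl rfl h1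
  exact ⟨GroupTwo.lift h1 h2, congrArg Units.val (PresentedGroup.toGroup.of _),
    congrArg Units.val (PresentedGroup.toGroup.of _),
    congrArg Units.val (PresentedGroup.toGroup.of _),
    congrArg Units.val (PresentedGroup.toGroup.of _)⟩

theorem pow_diag_fin_two (x y : F) (n : ℕ) :
    (!![x, 0; 0, y] : Matrix (Fin 2) (Fin 2) F) ^ n = !![x ^ n, 0; 0, y ^ n] := by
  induction n with
  | zero => simp [Matrix.one_fin_two]
  | succ n ih => simp [pow_succ, ih]

-- The quaternion subgroup is killed, and since `t ^ m = t⁻¹` the swap of coordinates serves as ν.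
open Matrix in
theorem exists_dihedralRep (hm : (3 ^ l : ℤ) ∣ m + 1) {ζ : F} (hζ : ζ ^ 3 ^ l = 1) :
    ∃ D : GroupTwo l m →* GL (Fin 2) F,
      (D (PresentedGroup.of 0)).val = !![ζ, 0; 0, ζ⁻¹] ∧
      (D (PresentedGroup.of 1)).val = 1 ∧
      (D (PresentedGroup.of 2)).val = 1 ∧
      (D (PresentedGroup.of 3)).val = !![0, 1; 1, 0] := by
  have hζ0 : ζ ≠ 0 := by
    rintro rfl
    simp at hζ
  set t : GL (Fin 2) F := GeneralLinearGroup.mkOfDetNeZero !![ζ, 0; 0, ζ⁻¹] (by simp [hζ0]) with ht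
  set n : GL (Fin 2) F := GeneralLinearGroup.mkOfDetNeZero !![0, 1; 1, 0] (by simp) with hn
  have hta : t.val = !![ζ, 0; 0, ζ⁻¹] := rfl
  have hna : n.val = !![0, 1; 1, 0] := rfl
  have h1 : RelationsOne l t 1 1 := by
    refine ⟨?_, by simp, by simp, by simp, by simp, by simp⟩
    ext1
    rw [Units.val_pow_eq_pow_val, hta, pow_diag_fin_two, inv_pow, hζ]
    simp [one_fin_two]
  have h2 : RelationsTwo m t 1 1 n := by
    refine ⟨?_, by simp, by simp, ?_⟩
    · ext1
      simp [pow_two, hna, one_fin_two]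
    · rw [RelationsTwo.zpow_t h1 hm, mul_inv_eq_iff_eq_mul, eq_inv_mul_iff_mul_eq]
      ext1
      simp [hta, hna, hζ0]
  exact ⟨GroupTwo.lift h1 h2, congrArg Units.val (PresentedGroup.toGroup.of _),
    congrArg Units.val (PresentedGroup.toGroup.of _),
    congrArg Units.val (PresentedGroup.toGroup.of _),
    congrArg Units.val (PresentedGroup.toGroup.of _)⟩

end Representations

/-! ### Finiteness, exponent and roots of unity in k -/

section Exponent

variable {l : ℕ} {m : ℤ}

theorem finite_groupOne (l : ℕ) : Finite (GroupOne l) :=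
  Finite.of_surjective _ ((relationsOne_groupOne l).surjective (closure_groupOne l))

theorem finite_groupTwo (hm : (3 ^ l : ℤ) ∣ m + 1) : Finite (GroupTwo l m) :=
  Finite.of_surjective _ (RelationsTwo.surjective (relationsOne_groupTwo l m)
    (relationsTwo_groupTwo l m) hm (closure_groupTwo l m))

/-- The exponent does not involve k, so a complex representation may be used: it sends λν to a
diagonal matrix with an entry `ε ^ 3` of order 8. -/
theorem eight_dvd_exponent (hl : 1 ≤ l) (hm : (3 ^ l : ℤ) ∣ m + 1) :
    8 ∣ Monoid.exponent (GroupTwo l m) := by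
  have hε : IsPrimitiveRoot (Complex.exp (2 * Real.pi * Complex.I / (8 : ℕ))) 8 :=
    Complex.isPrimitiveRoot_exp 8 (by norm_num)
  generalize Complex.exp (2 * Real.pi * Complex.I / (8 : ℕ)) = ε at hε
  obtain ⟨U, -, h1, -, h3⟩ := exists_quaternionRep hm hl hε
  have h4 := Monoid.pow_exponent_eq_one
    (PresentedGroup.of 1 * PresentedGroup.of 3 : GroupTwo l m)
  have h5 : (U (PresentedGroup.of 1 * PresentedGroup.of 3)).val = !![ε ^ 3, 0; 0, -ε] := by
    simp [h1, h3]
  have h6 := congrArg (fun g => (U g).val 0 0) h4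
  simp only [map_pow, Units.val_pow_eq_pow_val, h5, pow_diag_fin_two, map_one, Units.val_one,
    Matrix.one_apply_eq, Matrix.of_apply, Matrix.cons_val_zero] at h6
  exact ((hε.pow_of_coprime 3 (by norm_num)).pow_eq_one_iff_dvd _).1 h6

theorem three_pow_dvd_exponent (hm : (3 ^ l : ℤ) ∣ m + 1) :
    3 ^ l ∣ Monoid.exponent (GroupTwo l m) := by
  have hζ : IsPrimitiveRoot (Complex.exp (2 * Real.pi * Complex.I / (3 ^ l : ℕ))) (3 ^ l) :=
    Complex.isPrimitiveRoot_exp (3 ^ l) (by positivity)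
  generalize Complex.exp (2 * Real.pi * Complex.I / (3 ^ l : ℕ)) = ζ at hζ
  obtain ⟨D, h0, -⟩ := exists_dihedralRep hm hζ.pow_eq_one
  have h4 := Monoid.pow_exponent_eq_one (PresentedGroup.of 0 : GroupTwo l m)
  have h6 := congrArg (fun g => (D g).val 0 0) h4
  simp only [map_pow, Units.val_pow_eq_pow_val, h0, pow_diag_fin_two, map_one, Units.val_one,
    Matrix.one_apply_eq, Matrix.of_apply, Matrix.cons_val_zero] at h6
  exact (hζ.pow_eq_one_iff_dvd _).1 h6

theorem exists_primitiveRoots (hl : 1 ≤ l) (hm : (3 ^ l : ℤ) ∣ m + 1) {k : Type*} [Field k] {ξ : k}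
    (hξ : IsPrimitiveRoot ξ (Monoid.exponent (GroupTwo l m))) :
    (∃ ε : k, IsPrimitiveRoot ε 8) ∧ ∃ ζ : k, IsPrimitiveRoot ζ (3 ^ l) := by
  have := finite_groupTwo hm
  have hpos : 0 < Monoid.exponent (GroupTwo l m) :=
    Nat.pos_of_ne_zero Monoid.exponent_ne_zero_of_finite
  obtain ⟨a, ha⟩ := eight_dvd_exponent hl hm
  obtain ⟨b, hb⟩ := three_pow_dvd_exponent hm
  exact ⟨⟨_, hξ.pow hpos (ha.trans (mul_comm _ _))⟩, ⟨_, hξ.pow hpos (hb.trans (mul_comm _ _))⟩⟩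

/-- Modulo 3, m - 1 is 1, so it cancels from (m + 1)(m - 1). -/
theorem three_pow_dvd_add_one (hm : m + 1 ≡ 0 [ZMOD 3]) (hm' : m ^ 2 ≡ 1 [ZMOD 3 ^ l]) :
    (3 ^ l : ℤ) ∣ m + 1 := by
  have h1 : (3 ^ l : ℤ) ∣ (m + 1) * (m - 1) := by
    have := hm'.symm.dvd
    rwa [show m ^ 2 - 1 = (m + 1) * (m - 1) by ring] at this
  refine IsCoprime.dvd_of_dvd_mul_right (IsCoprime.pow_left ?_) h1
  obtain ⟨c, hc⟩ := hm.symm.dvd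
  -- Bézout: with m + 1 = 3c, one has 3(1 - c) + (m - 1) = 1.
  exact ⟨1 - c, 1, by linarith⟩

end Exponent

/-! ### Linear forms from matrix coefficients -/

section LinearForms

variable {k K G ι : Type*} [Field k] [Field K] [Algebra k K] [Group G] [Fintype G]
  [Fintype ι] [DecidableEq ι]

/-- The linear form in the regular representation given by an entry of a matrix representation. -/
def linForm (X : G → K) (r : G →* GL ι k) (i j : ι) : K :=
  ∑ g, (r g⁻¹).val i j • X g

/-- After the substitution g ↦ h⁻¹g, the inverse in `linForm` makes each row of forms transform like
the standard basis under `r`. -/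
theorem map_linForm {σ : G →* (K ≃ₐ[k] K)} {X : G → K} (hσ : ∀ g h, σ g (X h) = X (g * h))
    (r : G →* GL ι k) (i j : ι) (h : G) :
    σ h (linForm X r i j) = ∑ l, (r h).val l j • linForm X r i l := by
  have h1 : ∀ g, (r (h⁻¹ * g)⁻¹).val i j = ∑ l, (r g⁻¹).val i l * (r h).val l j := by
    intro g
    rw [mul_inv_rev, inv_inv, map_mul, Units.val_mul, Matrix.mul_apply]
  simp only [linForm, map_sum, map_smul, hσ]
  rw [← Equiv.sum_comp (Equiv.mulLeft h⁻¹)]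
  simp only [Equiv.coe_mulLeft, h1, mul_inv_cancel_left, Finset.smul_sum, Finset.sum_smul]
  rw [Finset.sum_comm]
  simp only [smul_smul, mul_comm]

theorem linForm_mem_span (X : G → K) (r : G →* GL ι k) (i j : ι) :
    linForm X r i j ∈ Submodule.span k (Set.range X) :=
  Submodule.sum_mem _ fun g _ => Submodule.smul_mem _ _ (Submodule.subset_span ⟨g, rfl⟩)

end LinearForms

theorem linearIndependent_of_coeff {k V G : Type*} [Field k] [AddCommGroup V] [Module k V]
    [Fintype G] {X : G → V} (hX : LinearIndependent k X) {d : ℕ} {Y : Fin d → V}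
    {c : Fin d → G → k} (hY : ∀ i, Y i = ∑ g, c i g • X g)
    (hc : ∀ a : Fin d → k, (∀ g, ∑ i, a i * c i g = 0) → a = 0) : LinearIndependent k Y := by
  rw [Fintype.linearIndependent_iff]
  intro a ha
  refine congrFun (hc a fun g => ?_)
  refine Fintype.linearIndependent_iff.1 hX (fun g => ∑ i, a i * c i g) ?_ g
  rw [← ha]
  simp only [hY, Finset.sum_smul, Finset.smul_sum, smul_smul]
  exact Finset.sum_comm

theorem map_eq_of_closure_eq_top {k K G : Type*} [Field k] [Field K] [Algebra k K] [Group G]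
    {σ : G →* (K ≃ₐ[k] K)} {S : Set G} (hS : Subgroup.closure S = ⊤)
    {t : K} (ht : ∀ s ∈ S, σ s t = t) (g : G) : σ g t = t := by
  have hg : g ∈ Subgroup.closure S := hS ▸ Subgroup.mem_top g
  induction hg using Subgroup.closure_induction with
  | mem s hs => exact ht s hs
  | one => rw [map_one, AlgEquiv.one_apply]
  | mul a b _ _ ha hb => rw [map_mul, AlgEquiv.mul_apply, hb, ha]
  | inv a _ ha =>
    rw [map_inv]
    nth_rewrite 1 [← ha]
    exact (σ a).symm_apply_apply t

/-- By algebraic independence, one nonzero value over `k` shows that a polynomial in `Y` is nonzero.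
-/
theorem aeval_ne_zero_of_eval_ne_zero {k K ι : Type*} [Field k] [Field K] [Algebra k K] {Y : ι → K}
    (hY : AlgebraicIndependent k Y) (p : MvPolynomial ι k) (a : ι → k)
    (h : MvPolynomial.eval a p ≠ 0) : MvPolynomial.aeval Y p ≠ 0 := by
  intro h0
  rw [(injective_iff_map_eq_zero _).1 hY p h0, map_zero] at h
  exact h rfl

open IntermediateField in
theorem relrank_adjoin_root_le {k K : Type*} [Field k] [Field K] [Algebra k K]
    {E : IntermediateField k K} {z : K} {n : ℕ} (hn : 0 < n) (hz : z ^ n ∈ E) :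
    relrank E (E ⊔ adjoin k {z}) ≤ n := by
  refine relrank_adjoin_singleton_le rfl (Polynomial.X ^ n - Polynomial.C ⟨z ^ n, hz⟩)
    (Polynomial.X_pow_sub_C_ne_zero hn _) (Polynomial.natDegree_X_pow_sub_C).le ?_
  simp


/-! ### Klein's forms and their behaviour under the generators -/

section Invariants

/-- The two quartic forms that are relative invariants of the binary tetrahedral group are
`tetraForm ω x y` for the two primitive cube roots of unity `ω`. -/
def tetraForm {R : Type*} [CommRing R] (ω x y : R) : R :=
  x ^ 4 + 2 * (2 * ω + 1) * x ^ 2 * y ^ 2 + y ^ 4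

/-- The sextic relative invariant of the binary octahedral group. -/
def octaForm {R : Type*} [CommRing R] (x y : R) : R :=
  x * y * (x ^ 4 - y ^ 4)

variable {R : Type*} [CommRing R]

theorem map_tetraForm {S : Type*} [CommRing S] (f : R →+* S) (ω x y : R) :
    f (tetraForm ω x y) = tetraForm (f ω) (f x) (f y) := by
  simp only [tetraForm, map_add, map_mul, map_pow, map_one, map_ofNat]

theorem map_octaForm {S : Type*} [CommRing S] (f : R →+* S) (x y : R) :
    f (octaForm x y) = octaForm (f x) (f y) := by
  simp [octaForm]

/-- The two middle coefficients are opposite with square -12, whence 14 = 2 + 12. -/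
theorem tetraForm_mul_tetraForm {ω : R} (hω : ω ^ 2 + ω + 1 = 0) (x y : R) :
    tetraForm ω x y * tetraForm (ω ^ 2) x y = x ^ 8 + 14 * x ^ 4 * y ^ 4 + y ^ 8 := by
  have h : ω ^ 2 = -ω - 1 := by linear_combination hω
  rw [tetraForm, tetraForm, h]
  linear_combination (-16 * x ^ 4 * y ^ 4) * hω

theorem tetraForm_tau {F : Type*} [Field F] (h2 : (2 : F) ≠ 0) {i ω : F} (hi : i ^ 2 = -1)
    (hω : ω ^ 2 + ω + 1 = 0) (x y : F) :
    tetraForm ω (-(1 + i) / 2 * x + (1 + i) / 2 * y) ((i - 1) / 2 * x + (i - 1) / 2 * y) =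
      ω * tetraForm ω x y := by
  set X := -(1 + i) / 2 * x + (1 + i) / 2 * y with hX
  set Y := (i - 1) / 2 * x + (i - 1) / 2 * y with hY
  -- The form involves only squares of its arguments, and up to the factors ±i/2 these are the
  -- squares of x - y and x + y.
  have h1 : X ^ 2 = i / 2 * (x - y) ^ 2 := by
    rw [hX]
    field_simp
    linear_combination ((x - y) ^ 2) * hi
  have h3 : Y ^ 2 = -i / 2 * (x + y) ^ 2 := by
    rw [hY]
    field_simp
    linear_combination ((x + y) ^ 2) * hi
  have h4 : tetraForm ω X Y = (X ^ 2) ^ 2 + 2 * (2 * ω + 1) * X ^ 2 * Y ^ 2 + (Y ^ 2) ^ 2 := by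
    rw [tetraForm]
    ring
  rw [h4, h1, h3, tetraForm]
  field_simp
  linear_combination (16 * x ^ 2 * y ^ 2 + 8 * ω * x ^ 2 * y ^ 2 - 4 * ω * (x ^ 4 + y ^ 4)) * hi -
    16 * x ^ 2 * y ^ 2 * hω

theorem octaForm_tau {F : Type*} [Field F] (h2 : (2 : F) ≠ 0) {i : F} (hi : i ^ 2 = -1) (x y : F) :
    octaForm (-(1 + i) / 2 * x + (1 + i) / 2 * y) ((i - 1) / 2 * x + (i - 1) / 2 * y) =
      octaForm x y := by
  rw [octaForm, octaForm]
  field_simp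
  grind

theorem tetraForm_rho {i : R} (hi : i ^ 2 = -1) (ω x y : R) :
    tetraForm ω (i * x) (-i * y) = tetraForm ω x y := by
  have h4 : i ^ 4 = 1 := by linear_combination (i ^ 2 - 1) * hi
  rw [tetraForm, tetraForm]
  linear_combination (x ^ 4 + 2 * (2 * ω + 1) * x ^ 2 * y ^ 2 + y ^ 4) * h4

theorem octaForm_rho {i : R} (hi : i ^ 2 = -1) (x y : R) :
    octaForm (i * x) (-i * y) = octaForm x y := by
  rw [octaForm, octaForm]
  linear_combination (-x * y * (x ^ 4 - y ^ 4) * (i ^ 4 - i ^ 2 + 1)) * hi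

theorem tetraForm_lambda (ω x y : R) : tetraForm ω (-y) x = tetraForm ω x y := by
  rw [tetraForm, tetraForm]
  ring

theorem octaForm_lambda (x y : R) : octaForm (-y) x = octaForm x y := by
  rw [octaForm, octaForm]
  ring

/-- Replacing ω by -1 - ω changes the sign of the middle coefficient 2(2ω + 1). -/
theorem tetraForm_nu {ε ω ω' : R} (hε : ε ^ 4 = -1) (hω : ω + ω' = -1) (x y : R) :
    tetraForm ω (ε ^ 3 * y) (ε * x) = -tetraForm ω' x y := by
  rw [tetraForm, tetraForm]
  have h : ω' = -1 - ω := by linear_combination hω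
  rw [h]
  linear_combination ((ε ^ 8 - ε ^ 4 + 1) * y ^ 4 + x ^ 4 +
    2 * (2 * ω + 1) * x ^ 2 * y ^ 2 * (ε ^ 4 - 1)) * hε

theorem octaForm_nu {ε : R} (hε : ε ^ 4 = -1) (x y : R) :
    octaForm (ε ^ 3 * y) (ε * x) = -octaForm x y := by
  rw [octaForm, octaForm]
  linear_combination (x * y * (y ^ 4 * (ε ^ 12 - ε ^ 8 + ε ^ 4 - 1) - x ^ 4 * (ε ^ 4 - 1))) * hε

end Invariants

/-! ### Degree bounds over the invariants -/

section Generation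

-- The equation of x/y over Φ³/f²; the square of f(z, 1) has degree 10, so it cannot disturb the
-- leading term.
open Polynomial in
theorem monic_tetra {R : Type*} [CommRing R] [Nontrivial R] (a c : R) :
    ((X ^ 4 + C a * X ^ 2 + 1) ^ 3 - C c * (X * (X ^ 4 - 1)) ^ 2 : R[X]).Monic ∧
    ((X ^ 4 + C a * X ^ 2 + 1) ^ 3 - C c * (X * (X ^ 4 - 1)) ^ 2 : R[X]).natDegree ≤ 12 := by
  constructor
  · monicity!
  · compute_degree!

-- The equation of x/y over (ΦΨ)³/f⁴; here f(z, 1)⁴ has degree 20.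
open Polynomial in
theorem monic_octa {R : Type*} [CommRing R] [Nontrivial R] (c : R) :
    ((X ^ 8 + 14 * X ^ 4 + 1) ^ 3 - C c * (X * (X ^ 4 - 1)) ^ 4 : R[X]).Monic ∧
    ((X ^ 8 + 14 * X ^ 4 + 1) ^ 3 - C c * (X * (X ^ 4 - 1)) ^ 4 : R[X]).natDegree ≤ 24 := by
  constructor
  · monicity!
  · compute_degree!

variable {k K : Type*} [Field k] [Field K] [Algebra k K]

theorem tetraForm_mem (F : IntermediateField k K) {ω x y : K} (hω : ω ∈ F) (hx : x ∈ F)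
    (hy : y ∈ F) : tetraForm ω x y ∈ F := by
  have h2 : (2 : K) ∈ F := ofNat_mem F 2
  exact add_mem (add_mem (pow_mem hx 4) (mul_mem (mul_mem (mul_mem h2
    (add_mem (mul_mem h2 hω) (one_mem F))) (pow_mem hx 2)) (pow_mem hy 2))) (pow_mem hy 4)

theorem octaForm_mem (F : IntermediateField k K) {x y : K} (hx : x ∈ F) (hy : y ∈ F) :
    octaForm x y ∈ F :=
  mul_mem (mul_mem hx hy) (sub_mem (pow_mem hx 4) (pow_mem hy 4))

theorem tetraForm_div {ω x y : K} (hy : y ≠ 0) :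
    tetraForm ω (x / y) 1 = tetraForm ω x y / y ^ 4 := by
  rw [tetraForm, tetraForm]
  field_simp

theorem octaForm_div {x y : K} (hy : y ≠ 0) : octaForm (x / y) 1 = octaForm x y / y ^ 6 := by
  rw [octaForm, octaForm]
  field_simp

/-- Generating invariants in `x, y, u` of the group `GroupOne l`. -/
def invariantsOne (ω : K) (n : ℕ) (x y u : K) : Fin 3 → K :=
  ![tetraForm ω x y ^ 3 / octaForm x y ^ 2,
    tetraForm ω x y * tetraForm (ω ^ 2) x y / octaForm x y,
    u ^ n * (tetraForm ω x y / tetraForm (ω ^ 2) x y)]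

/-- Generating invariants in `x, y, u, v` of the group `GroupTwo l m`. -/
def invariantsTwo (ω : K) (n j : ℕ) (x y u v : K) : Fin 4 → K :=
  ![(tetraForm ω x y * tetraForm (ω ^ 2) x y) ^ 3 / octaForm x y ^ 4,
    (tetraForm ω x y ^ 3 + tetraForm (ω ^ 2) x y ^ 3) / octaForm x y ^ 2 *
      ((tetraForm ω x y ^ 2 * u ^ n + tetraForm (ω ^ 2) x y ^ 2 * v ^ n) /
        (tetraForm ω x y ^ 2 * u ^ n - tetraForm (ω ^ 2) x y ^ 2 * v ^ n)),
    tetraForm ω x y * tetraForm (ω ^ 2) x y / octaForm x y *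
      ((tetraForm ω x y ^ 3 + tetraForm (ω ^ 2) x y ^ 3) / octaForm x y ^ 2),
    (u / v) ^ j * u + (v / u) ^ j * v]

open IntermediateField

theorem relrank_le_mul {E F F' : IntermediateField k K} (h : E ≤ F) (h' : F ≤ F') {a b : ℕ}
    (ha : relrank E F ≤ a) (hb : relrank F F' ≤ b) : relrank E F' ≤ (a * b : ℕ) := by
  rw [← relrank_mul_relrank h h', Nat.cast_mul]
  exact mul_le_mul' ha hb

/-- Adjoin x/y, y, u in turn. ΦΨ/f is homogeneous of degree 2, so it gives y² over E(x/y); Φ/Ψ has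
degree 0, so the third invariant gives uⁿ. -/
theorem exists_field_of_invariantsOne_mem {ω : k} {x y u : K} {n : ℕ} (hn : 0 < n) (hy : y ≠ 0)
    (hΦ : tetraForm (algebraMap k K ω) x y ≠ 0) (hΨ : tetraForm (algebraMap k K ω ^ 2) x y ≠ 0)
    (hf : octaForm x y ≠ 0)
    {E : IntermediateField k K} (hE : ∀ i, invariantsOne (algebraMap k K ω) n x y u i ∈ E) :
    ∃ F, E ≤ F ∧ (x ∈ F ∧ y ∈ F ∧ u ∈ F) ∧ relrank E F ≤ (12 * 2 * n : ℕ) := by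
  set w := algebraMap k K ω with hw
  have h0 := hE 0
  have h1 := hE 1
  have h2 := hE 2
  simp only [invariantsOne, Matrix.cons_val] at h0 h1 h2
  set F₁ := E ⊔ adjoin k {x / y} with hF₁
  set F₂ := F₁ ⊔ adjoin k {y} with hF₂
  set F₃ := F₂ ⊔ adjoin k {u} with hF₃
  have hEF₁ : E ≤ F₁ := le_sup_left
  have hF₁₂ : F₁ ≤ F₂ := le_sup_left
  have hF₂₃ : F₂ ≤ F₃ := le_sup_left
  have hz : x / y ∈ F₁ := (le_sup_right : _ ≤ F₁) (mem_adjoin_simple_self k _)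
  have hwE : ∀ F : IntermediateField k K, w ∈ F := fun F => F.algebraMap_mem ω
  have hΦ₁ := tetraForm_mem F₁ (hwE F₁) hz (one_mem F₁)
  have hΨ₁ := tetraForm_mem F₁ (pow_mem (hwE F₁) 2) hz (one_mem F₁)
  have hf₁ := octaForm_mem F₁ hz (one_mem F₁)
  have r₁ : relrank E F₁ ≤ (12 : ℕ) := by
    obtain ⟨hmonic, hdeg⟩ := monic_tetra (R := E) (2 * (2 * ⟨w, hwE E⟩ + 1)) ⟨_, h0⟩
    refine relrank_adjoin_singleton_le rfl _ hmonic.ne_zero hdeg ?_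
    have e1 : (x / y) ^ 4 + 2 * (2 * w + 1) * (x / y) ^ 2 + 1 = tetraForm w x y / y ^ 4 := by
      rw [← tetraForm_div hy, tetraForm]
      ring
    have e2 : x / y * ((x / y) ^ 4 - 1) = octaForm x y / y ^ 6 := by
      rw [← octaForm_div hy, octaForm]
      ring
    simp only [map_sub, map_add, map_mul, map_pow, Polynomial.aeval_X, Polynomial.aeval_C, map_one,
      map_ofNat]
    simp only [IntermediateField.algebraMap_apply]
    rw [e1, e2]
    field_simp
    ring
  have r₂ : relrank F₁ F₂ ≤ (2 : ℕ) := by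
    refine relrank_adjoin_root_le (by norm_num) ?_
    have e : y ^ 2 = tetraForm w x y * tetraForm (w ^ 2) x y / octaForm x y *
        (octaForm (x / y) 1 / (tetraForm w (x / y) 1 * tetraForm (w ^ 2) (x / y) 1)) := by
      rw [tetraForm_div hy, tetraForm_div hy, octaForm_div hy]
      field_simp
    rw [e]
    exact mul_mem (hEF₁ h1) (div_mem hf₁ (mul_mem hΦ₁ hΨ₁))
  have r₃ : relrank F₂ F₃ ≤ n := by
    refine relrank_adjoin_root_le hn ?_
    have e : u ^ n = u ^ n * (tetraForm w x y / tetraForm (w ^ 2) x y) *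
        (tetraForm (w ^ 2) (x / y) 1 / tetraForm w (x / y) 1) := by
      rw [tetraForm_div hy, tetraForm_div hy]
      field_simp
    rw [e]
    exact mul_mem (hF₁₂ (hEF₁ h2)) (hF₁₂ (div_mem hΨ₁ hΦ₁))
  have hyF : y ∈ F₂ := (le_sup_right : _ ≤ F₂) (mem_adjoin_simple_self k _)
  refine ⟨F₃, hEF₁.trans (hF₁₂.trans hF₂₃), ⟨?_, hF₂₃ hyF,
    (le_sup_right : _ ≤ F₃) (mem_adjoin_simple_self k _)⟩,
    relrank_le_mul (hEF₁.trans hF₁₂) hF₂₃ (relrank_le_mul hEF₁ hF₁₂ r₁ r₂) r₃⟩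
  rw [← div_mul_cancel₀ x hy]
  exact hF₂₃ (mul_mem (hF₁₂ hz) hyF)

/-- Adjoin x/y, u/v, y in turn. Having degree 0, κ lies in E(x/y) and can be divided out of the
invariants there. -/
theorem exists_field_of_invariantsTwo_mem {ω : k} (hω : ω ^ 2 + ω + 1 = 0) (htwo : (2 : K) ≠ 0)
    {x y u v : K} {n j : ℕ} (hn : 0 < n)
    (hy : y ≠ 0) (hu : u ≠ 0) (hv : v ≠ 0)
    (hΦ : tetraForm (algebraMap k K ω) x y ≠ 0) (hΨ : tetraForm (algebraMap k K ω ^ 2) x y ≠ 0)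
    (hf : octaForm x y ≠ 0)
    (hsum : tetraForm (algebraMap k K ω) x y ^ 3 + tetraForm (algebraMap k K ω ^ 2) x y ^ 3 ≠ 0)
    (hsub : tetraForm (algebraMap k K ω) x y ^ 2 * u ^ n -
      tetraForm (algebraMap k K ω ^ 2) x y ^ 2 * v ^ n ≠ 0)
    (huv : u ^ (2 * j + 1) + v ^ (2 * j + 1) ≠ 0)
    {E : IntermediateField k K} (hE : ∀ i, invariantsTwo (algebraMap k K ω) n j x y u v i ∈ E) :
    ∃ F, E ≤ F ∧ (x ∈ F ∧ y ∈ F ∧ u ∈ F ∧ v ∈ F) ∧ relrank E F ≤ (24 * n * 2 : ℕ) := by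
  set w := algebraMap k K ω with hw
  have hw1 : w ^ 2 + w + 1 = 0 := by
    rw [hw, ← map_pow, ← map_add, ← map_one (algebraMap k K), ← map_add, hω, map_zero]
  have h0 := hE 0
  have h1 := hE 1
  have h2 := hE 2
  have h3 := hE 3
  simp only [invariantsTwo, Matrix.cons_val] at h0 h1 h2 h3
  set F₁ := E ⊔ adjoin k {x / y} with hF₁
  set F₂ := F₁ ⊔ adjoin k {u / v} with hF₂
  set F₃ := F₂ ⊔ adjoin k {y} with hF₃
  have hEF₁ : E ≤ F₁ := le_sup_left
  have hF₁₂ : F₁ ≤ F₂ := le_sup_left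
  have hF₂₃ : F₂ ≤ F₃ := le_sup_left
  have hz : x / y ∈ F₁ := (le_sup_right : _ ≤ F₁) (mem_adjoin_simple_self k _)
  have hwE : ∀ F : IntermediateField k K, w ∈ F := fun F => F.algebraMap_mem ω
  have hΦ₁ := tetraForm_mem F₁ (hwE F₁) hz (one_mem F₁)
  have hΨ₁ := tetraForm_mem F₁ (pow_mem (hwE F₁) 2) hz (one_mem F₁)
  have hf₁ := octaForm_mem F₁ hz (one_mem F₁)
  have r₁ : relrank E F₁ ≤ (24 : ℕ) := by
    obtain ⟨hmonic, hdeg⟩ := monic_octa (R := E) ⟨_, h0⟩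
    refine relrank_adjoin_singleton_le rfl _ hmonic.ne_zero hdeg ?_
    have e1 : (x / y) ^ 8 + 14 * (x / y) ^ 4 + 1 =
        tetraForm w x y * tetraForm (w ^ 2) x y / y ^ 8 := by
      rw [tetraForm_mul_tetraForm hw1]
      field_simp
    have e2 : x / y * ((x / y) ^ 4 - 1) = octaForm x y / y ^ 6 := by
      rw [← octaForm_div hy, octaForm]
      ring
    simp only [map_sub, map_add, map_mul, map_pow, Polynomial.aeval_X, Polynomial.aeval_C, map_one,
      map_ofNat]
    simp only [IntermediateField.algebraMap_apply]
    rw [e1, e2]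
    field_simp
    ring
  set κ := (tetraForm w x y ^ 3 + tetraForm (w ^ 2) x y ^ 3) / octaForm x y ^ 2 with hκ
  have hκ0 : κ ≠ 0 := div_ne_zero hsum (pow_ne_zero _ hf)
  have hκ₁ : κ ∈ F₁ := by
    have e : κ = (tetraForm w (x / y) 1 ^ 3 + tetraForm (w ^ 2) (x / y) 1 ^ 3) /
        octaForm (x / y) 1 ^ 2 := by
      rw [tetraForm_div hy, tetraForm_div hy, octaForm_div hy, hκ]
      field_simp
    rw [e]
    exact div_mem (add_mem (pow_mem hΦ₁ 3) (pow_mem hΨ₁ 3)) (pow_mem hf₁ 2)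
  have r₂ : relrank F₁ F₂ ≤ n := by
    refine relrank_adjoin_root_le hn ?_
    set ρ := κ * ((tetraForm w x y ^ 2 * u ^ n + tetraForm (w ^ 2) x y ^ 2 * v ^ n) /
      (tetraForm w x y ^ 2 * u ^ n - tetraForm (w ^ 2) x y ^ 2 * v ^ n)) with hρ
    have hvn : v ^ n ≠ 0 := pow_ne_zero _ hv
    have hsubκ : ρ - κ = κ * (2 * tetraForm (w ^ 2) x y ^ 2 * v ^ n) /
        (tetraForm w x y ^ 2 * u ^ n - tetraForm (w ^ 2) x y ^ 2 * v ^ n) := by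
      rw [hρ]
      field_simp
      ring
    have haddκ : ρ + κ = κ * (2 * tetraForm w x y ^ 2 * u ^ n) /
        (tetraForm w x y ^ 2 * u ^ n - tetraForm (w ^ 2) x y ^ 2 * v ^ n) := by
      rw [hρ]
      field_simp
      ring
    -- With A = Φ²uⁿ and B = Ψ²vⁿ, this solves ρ/κ = (A + B)/(A - B) for A/B.
    have e : (u / v) ^ n = (ρ + κ) / (ρ - κ) *
        (tetraForm (w ^ 2) (x / y) 1 / tetraForm w (x / y) 1) ^ 2 := by
      rw [hsubκ, haddκ, tetraForm_div hy, tetraForm_div hy]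
      field_simp
      rw [div_pow, div_mul_cancel₀ _ hvn]
    rw [e]
    exact mul_mem (div_mem (add_mem (hEF₁ h1) hκ₁) (sub_mem (hEF₁ h1) hκ₁))
      (pow_mem (div_mem hΨ₁ hΦ₁) 2)
  have r₃ : relrank F₂ F₃ ≤ (2 : ℕ) := by
    refine relrank_adjoin_root_le (by norm_num) (hF₁₂ ?_)
    have e : y ^ 2 = tetraForm w x y * tetraForm (w ^ 2) x y / octaForm x y * κ *
        (octaForm (x / y) 1 / (tetraForm w (x / y) 1 * tetraForm (w ^ 2) (x / y) 1)) / κ := by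
      rw [tetraForm_div hy, tetraForm_div hy, octaForm_div hy]
      field_simp
    rw [e]
    exact div_mem (mul_mem (hEF₁ h2) (div_mem hf₁ (mul_mem hΦ₁ hΨ₁))) hκ₁
  have hyF : y ∈ F₃ := (le_sup_right : _ ≤ F₃) (mem_adjoin_simple_self k _)
  have hw₂ : u / v ∈ F₂ := (le_sup_right : _ ≤ F₂) (mem_adjoin_simple_self k _)
  -- The fourth invariant is `v` times a function of `u / v`.
  have hvF : v ∈ F₂ := by
    have e0 : (u / v) ^ (j + 1) + (v / u) ^ j =
        (u ^ (2 * j + 1) + v ^ (2 * j + 1)) / (u ^ j * v ^ (j + 1)) := by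
      rw [div_pow, div_pow]
      field_simp
      ring
    have e0' : (u / v) ^ (j + 1) + (v / u) ^ j ≠ 0 := by
      rw [e0]
      exact div_ne_zero huv (mul_ne_zero (pow_ne_zero _ hu) (pow_ne_zero _ hv))
    have e : v = ((u / v) ^ j * u + (v / u) ^ j * v) / ((u / v) ^ (j + 1) + (v / u) ^ j) := by
      rw [eq_div_iff e0', pow_succ]
      field_simp
    rw [e]
    refine div_mem (hF₁₂ (hEF₁ h3)) (add_mem (pow_mem hw₂ _) (pow_mem ?_ _))
    rw [← inv_div]
    exact inv_mem hw₂
  refine ⟨F₃, hEF₁.trans (hF₁₂.trans hF₂₃), ⟨?_, hyF, ?_, hF₂₃ hvF⟩,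
    relrank_le_mul (hEF₁.trans hF₁₂) hF₂₃ (relrank_le_mul hEF₁ hF₁₂ r₁ r₂) r₃⟩
  · rw [← div_mul_cancel₀ x hy]
    exact mul_mem (hF₂₃ (hF₁₂ hz)) hyF
  · rw [← div_mul_cancel₀ u hv]
    exact hF₂₃ (mul_mem hw₂ hvF)

end Generation

/-! ### Invariance of the chosen functions -/

section Invariance

variable {K : Type*} [Field K]

theorem map_invariantsOne (f : K →+* K) (w : K) (n : ℕ) (x y u : K) (i : Fin 3) :
    f (invariantsOne w n x y u i) = invariantsOne (f w) n (f x) (f y) (f u) i := by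
  fin_cases i <;> simp [invariantsOne, map_tetraForm, map_octaForm]

theorem map_invariantsTwo (f : K →+* K) (w : K) (n j : ℕ) (x y u v : K) (i : Fin 4) :
    f (invariantsTwo w n j x y u v i) = invariantsTwo (f w) n j (f x) (f y) (f u) (f v) i := by
  fin_cases i <;> simp [invariantsTwo, map_tetraForm, map_octaForm]

variable {w : K} {n j : ℕ} {x y u v x' y' u' v' : K}

theorem invariantsOne_congr (hΦ : tetraForm w x' y' = tetraForm w x y)
    (hΨ : tetraForm (w ^ 2) x' y' = tetraForm (w ^ 2) x y) (hf : octaForm x' y' = octaForm x y) :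
    invariantsOne w n x' y' u = invariantsOne w n x y u := by
  rw [invariantsOne, invariantsOne, hΦ, hΨ, hf]

theorem invariantsTwo_congr (hΦ : tetraForm w x' y' = tetraForm w x y)
    (hΨ : tetraForm (w ^ 2) x' y' = tetraForm (w ^ 2) x y) (hf : octaForm x' y' = octaForm x y) :
    invariantsTwo w n j x' y' u v = invariantsTwo w n j x y u v := by
  rw [invariantsTwo, invariantsTwo, hΦ, hΨ, hf]

theorem invariantsOne_tau (hw : w ^ 3 = 1) (hΦ : tetraForm w x' y' = w * tetraForm w x y)
    (hΨ : tetraForm (w ^ 2) x' y' = w ^ 2 * tetraForm (w ^ 2) x y)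
    (hf : octaForm x' y' = octaForm x y) (hu : u' ^ n = w * u ^ n) :
    invariantsOne w n x' y' u' = invariantsOne w n x y u := by
  have hw0 : w ≠ 0 := by
    rintro rfl
    simp at hw
  rw [invariantsOne, invariantsOne, hΦ, hΨ, hf, hu, mul_pow, hw, one_mul]
  have e1 : w * tetraForm w x y * (w ^ 2 * tetraForm (w ^ 2) x y) =
      tetraForm w x y * tetraForm (w ^ 2) x y := by
    linear_combination (tetraForm w x y * tetraForm (w ^ 2) x y) * hw
  have e2 : w * u ^ n * (w * tetraForm w x y / (w ^ 2 * tetraForm (w ^ 2) x y)) =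
      u ^ n * (tetraForm w x y / tetraForm (w ^ 2) x y) := by
    field_simp
  rw [e1, e2]

/-- The factors cancel: ω²·ω on Φ²uⁿ, ω⁴·ω⁻¹ on Ψ²vⁿ, and ζ^(2j+1) or its inverse on the terms of
the last invariant. -/
theorem invariantsTwo_tau (hw : w ^ 3 = 1) (hΦ : tetraForm w x' y' = w * tetraForm w x y)
    (hΨ : tetraForm (w ^ 2) x' y' = w ^ 2 * tetraForm (w ^ 2) x y)
    (hf : octaForm x' y' = octaForm x y) {ζ : K} (hζ : ζ ^ (2 * j + 1) = 1) (hζn : ζ ^ n = w) :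
    invariantsTwo w n j x' y' (ζ * u) (ζ⁻¹ * v) = invariantsTwo w n j x y u v := by
  have hw0 : w ≠ 0 := by
    rintro rfl
    simp at hw
  have hζ0 : ζ ≠ 0 := by
    rintro rfl
    simp at hζ
  rw [invariantsTwo, invariantsTwo, hΦ, hΨ, hf]
  have e1 : w * tetraForm w x y * (w ^ 2 * tetraForm (w ^ 2) x y) =
      tetraForm w x y * tetraForm (w ^ 2) x y := by
    linear_combination (tetraForm w x y * tetraForm (w ^ 2) x y) * hw
  have e2 : (w * tetraForm w x y) ^ 3 = tetraForm w x y ^ 3 := by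
    rw [mul_pow, hw, one_mul]
  have e3 : (w ^ 2 * tetraForm (w ^ 2) x y) ^ 3 = tetraForm (w ^ 2) x y ^ 3 := by
    rw [mul_pow, ← pow_mul, mul_comm 2 3, pow_mul, hw, one_pow, one_mul]
  have e4 : (w * tetraForm w x y) ^ 2 * (ζ * u) ^ n = tetraForm w x y ^ 2 * u ^ n := by
    rw [mul_pow ζ, hζn]
    linear_combination (tetraForm w x y ^ 2 * u ^ n) * hw
  have e5 : (w ^ 2 * tetraForm (w ^ 2) x y) ^ 2 * (ζ⁻¹ * v) ^ n =
      tetraForm (w ^ 2) x y ^ 2 * v ^ n := by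
    rw [mul_pow ζ⁻¹, inv_pow, hζn]
    field_simp
    rw [hw, one_mul]
  have e6 : (ζ * u / (ζ⁻¹ * v)) ^ j * (ζ * u) = (u / v) ^ j * u := by
    have : ζ * u / (ζ⁻¹ * v) = ζ ^ 2 * (u / v) := by
      field_simp
    rw [this, mul_pow, ← pow_mul]
    linear_combination ((u / v) ^ j * u) * hζ
  have e7 : (ζ⁻¹ * v / (ζ * u)) ^ j * (ζ⁻¹ * v) = (v / u) ^ j * v := by
    have h1 : ζ⁻¹ * v / (ζ * u) = ζ⁻¹ ^ 2 * (v / u) := by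
      field_simp
    have h2 : ζ⁻¹ ^ (2 * j + 1) = 1 := by rw [inv_pow, hζ, inv_one]
    rw [h1, mul_pow, ← pow_mul]
    linear_combination ((v / u) ^ j * v) * h2
  rw [e1, e2, e3, e4, e5, e6, e7]

/-- κ, ΦΨ/f and the quotient of Φ²uⁿ ± Ψ²vⁿ all change sign, so the products with κ do not; the
terms of the last invariant are exchanged. -/
theorem invariantsTwo_nu (hΦ : tetraForm w x' y' = -tetraForm (w ^ 2) x y)
    (hΨ : tetraForm (w ^ 2) x' y' = -tetraForm w x y) (hf : octaForm x' y' = -octaForm x y) :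
    invariantsTwo w n j x' y' v u = invariantsTwo w n j x y u v := by
  rw [invariantsTwo, invariantsTwo, hΦ, hΨ, hf]
  have e1 : -tetraForm (w ^ 2) x y * -tetraForm w x y =
      tetraForm w x y * tetraForm (w ^ 2) x y := by
    ring
  have e2 : (-tetraForm (w ^ 2) x y) ^ 3 + (-tetraForm w x y) ^ 3 =
      -(tetraForm w x y ^ 3 + tetraForm (w ^ 2) x y ^ 3) := by
    ring
  have e3 : (-tetraForm (w ^ 2) x y) ^ 2 * v ^ n - (-tetraForm w x y) ^ 2 * u ^ n =
      -(tetraForm w x y ^ 2 * u ^ n - tetraForm (w ^ 2) x y ^ 2 * v ^ n) := by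
    ring
  have e4 : (-tetraForm (w ^ 2) x y) ^ 2 * v ^ n + (-tetraForm w x y) ^ 2 * u ^ n =
      tetraForm w x y ^ 2 * u ^ n + tetraForm (w ^ 2) x y ^ 2 * v ^ n := by
    ring
  rw [e1, e2, e3, e4, neg_sq, Even.neg_pow (by decide : Even 4), div_neg, neg_div, div_neg,
    neg_mul_neg, neg_mul_neg, add_comm ((v / u) ^ j * v)]

end Invariance

/-! ### Separating normal forms -/

section Faithful

variable {k : Type*} [Field k]

open Matrix

/-- The exponent of `a` decides between diagonal and antidiagonal; the nonzero entry of the first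
row is then a power of `ε ^ 2` and determines `j`. -/
theorem quaternion_pow_injective {ε : k} (hε : IsPrimitiveRoot ε 8) {a r : GL (Fin 2) k}
    (ha : a.val = !![0, 1; -1, 0]) (hr : r.val = !![ε ^ 2, 0; 0, -ε ^ 2]) {j j' : Fin 4}
    {b b' : Fin 2} (h : r ^ (j : ℕ) * a ^ (b : ℕ) = r ^ (j' : ℕ) * a ^ (b' : ℕ)) :
    j = j' ∧ b = b' := by
  have hε0 : ε ≠ 0 := hε.ne_zero (by norm_num)
  have h4 : IsPrimitiveRoot (ε ^ 2) 4 := hε.pow (by norm_num) (by norm_num)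
  have hj : ∀ {j j' : Fin 4}, (ε ^ 2) ^ (j : ℕ) = (ε ^ 2) ^ (j' : ℕ) → j = j' := fun h =>
    Fin.ext (h4.pow_inj (Fin.is_lt _) (Fin.is_lt _) h)
  have h1 := congrArg Units.val h
  simp only [Units.val_mul, Units.val_pow_eq_pow_val, ha, hr, pow_diag_fin_two] at h1
  have h00 := congrFun (congrFun h1 0) 0
  have h01 := congrFun (congrFun h1 0) 1
  fin_cases b <;> fin_cases b' <;> simp [hε0] at h00 h01 ⊢
  · exact hj h00
  · exact hj h01

theorem dihedral_pow_injective {N : ℕ} {ζ : k} (hζ : IsPrimitiveRoot ζ N) {t n : GL (Fin 2) k}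
    (ht : t.val = !![ζ, 0; 0, ζ⁻¹]) (hn : n.val = !![0, 1; 1, 0]) {i i' : Fin N}
    {c c' : Fin 2} (h : t ^ (i : ℕ) * n ^ (c : ℕ) = t ^ (i' : ℕ) * n ^ (c' : ℕ)) :
    i = i' ∧ c = c' := by
  have hζ0 : ζ ≠ 0 := hζ.ne_zero (by have := i.pos; omega)
  have hj : ∀ {j j' : Fin N}, ζ ^ (j : ℕ) = ζ ^ (j' : ℕ) → j = j' := fun h =>
    Fin.ext (hζ.pow_inj (Fin.is_lt _) (Fin.is_lt _) h)
  have h1 := congrArg Units.val h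
  simp only [Units.val_mul, Units.val_pow_eq_pow_val, ht, hn, pow_diag_fin_two] at h1
  have h00 := congrFun (congrFun h1 0) 0
  have h01 := congrFun (congrFun h1 0) 1
  fin_cases c <;> fin_cases c' <;> simp [hζ0] at h00 h01 ⊢
  · exact hj h00
  · exact hj h01

end Faithful

/-! ### The rational function field -/

section FractionField

theorem algebraicIndependent_algebraMap_X (k G : Type*) [Field k] :
    AlgebraicIndependent k fun g : G =>
      algebraMap (MvPolynomial G k) (FractionRing (MvPolynomial G k)) (MvPolynomial.X g) :=
  (MvPolynomial.algebraicIndependent_X G k).map'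
    (f := IsScalarTower.toAlgHom k (MvPolynomial G k) (FractionRing (MvPolynomial G k)))
    (IsFractionRing.injective _ _)

theorem adjoin_range_algebraMap_X (k G : Type*) [Field k] :
    IntermediateField.adjoin k (Set.range fun g : G =>
      algebraMap (MvPolynomial G k) (FractionRing (MvPolynomial G k)) (MvPolynomial.X g)) = ⊤ := by
  rw [eq_top_iff]
  intro x _
  have key : ∀ p : MvPolynomial G k, algebraMap _ (FractionRing (MvPolynomial G k)) p ∈
      IntermediateField.adjoin k (Set.range fun g : G =>
        algebraMap (MvPolynomial G k) (FractionRing (MvPolynomial G k)) (MvPolynomial.X g)) := by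
    intro p
    induction p using MvPolynomial.induction_on with
    | C a => exact IntermediateField.algebraMap_mem _ a
    | add p q hp hq =>
      rw [map_add]
      exact add_mem hp hq
    | mul_X p g hp =>
      rw [map_mul]
      exact mul_mem hp (IntermediateField.subset_adjoin _ _ ⟨g, rfl⟩)
  obtain ⟨p, q, _, rfl⟩ := IsFractionRing.div_surjective (A := MvPolynomial G k) x
  exact div_mem (key p) (key q)

end FractionField

/-! ### Rationality of both fixed fields -/

section Rationality

variable {k : Type*} [Field k] {l : ℕ}

open Matrix

theorem exists_quaternionRep_one (hl : 1 ≤ l) {ε : k} (hε : IsPrimitiveRoot ε 8) :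
    ∃ U : GroupOne l →* GL (Fin 2) k,
      (U (PresentedGroup.of 0)).val = !![-(1 + ε ^ 2) / 2, (ε ^ 2 - 1) / 2;
        (1 + ε ^ 2) / 2, (ε ^ 2 - 1) / 2] ∧
      (U (PresentedGroup.of 1)).val = !![0, 1; -1, 0] ∧
      (U (PresentedGroup.of 2)).val = !![ε ^ 2, 0; 0, -ε ^ 2] := by
  -- Any `m` with 3^l ∣ m + 1 would do; for -1 the divisibility is trivial.
  obtain ⟨U, h0, h1, h2, -⟩ := exists_quaternionRep (l := l) (m := -1) (by simp) hl hε
  have e : ∀ {g : GroupOne l} {g' : GroupTwo l (-1)},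
      GroupOne.lift (relationsOne_groupTwo l (-1)) g = g' →
      ((U.comp (GroupOne.lift (relationsOne_groupTwo l (-1)))) g).val = (U g').val :=
    fun h => congrArg (fun g => (U g).val) h
  exact ⟨U.comp (GroupOne.lift (relationsOne_groupTwo l (-1))),
    (e (PresentedGroup.toGroup.of _)).trans h0, (e (PresentedGroup.toGroup.of _)).trans h1,
    (e (PresentedGroup.toGroup.of _)).trans h2⟩

theorem exists_character_one {ζ : k} (hζ : ζ ^ 3 ^ l = 1) :
    ∃ χ : GroupOne l →* GL (Fin 1) k,
      (χ (PresentedGroup.of 0)).val = Matrix.scalar (Fin 1) ζ ∧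
      χ (PresentedGroup.of 1) = 1 ∧ χ (PresentedGroup.of 2) = 1 := by
  have h1 : RelationsOne l (Units.map (Matrix.scalar (Fin 1) : k →+* Matrix (Fin 1) (Fin 1) k).toMonoidHom
      (Units.ofPowEqOne ζ _ hζ (by positivity))) 1 1 := by
    refine ⟨?_, by simp, by simp, by simp, by simp, by simp⟩
    rw [← map_pow, Units.pow_ofPowEqOne, map_one]
  exact ⟨GroupOne.lift h1, congrArg Units.val (PresentedGroup.toGroup.of _),
    PresentedGroup.toGroup.of _, PresentedGroup.toGroup.of _⟩

theorem exists_cubeRoot (hl : 1 ≤ l) {ζ : k} (hζ : IsPrimitiveRoot ζ (3 ^ l)) :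
    ∃ ω : k, ω ^ 2 + ω + 1 = 0 ∧ ω ^ 3 = 1 ∧ ζ ^ 3 ^ (l - 1) = ω := by
  have h3 : IsPrimitiveRoot (ζ ^ 3 ^ (l - 1)) 3 :=
    hζ.pow (by positivity) (by rw [← pow_succ, Nat.sub_add_cancel hl])
  refine ⟨_, ?_, h3.pow_eq_one, rfl⟩
  have h1 := h3.pow_eq_one
  have h2 : ζ ^ 3 ^ (l - 1) - 1 ≠ 0 := sub_ne_zero.2 (h3.ne_one (by norm_num))
  refine (mul_eq_zero.1 ?_).resolve_left h2
  linear_combination h1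

open IntermediateField in
theorem isRationalExtension_groupOne {K : Type*} [Field K] [Algebra k K] (hl : 1 ≤ l) {ε ζ : k}
    (hε : IsPrimitiveRoot ε 8) (hζ : IsPrimitiveRoot ζ (3 ^ l)) {X : GroupOne l → K}
    (hX : AlgebraicIndependent k X) (htop : adjoin k (Set.range X) = ⊤)
    {σ : GroupOne l →* (K ≃ₐ[k] K)} (hσ : ∀ g h, σ g (X h) = X (g * h)) :
    IsRationalExtension k (fixedField σ.range) := by
  have hfin := finite_groupOne l
  have := Fintype.ofFinite (GroupOne l)
  obtain ⟨U, hUt, hUa, hUr⟩ := exists_quaternionRep_one hl hε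
  obtain ⟨χ, hχt, hχa, hχr⟩ := exists_character_one hζ.pow_eq_one
  obtain ⟨ω, hω, hω3, hζω⟩ := exists_cubeRoot hl hζ
  have h4 := hε.pow_four_eq_neg_one
  have h2 := hε.two_ne_zero_of_eight
  have hε2 : ε ^ 2 ≠ 1 := hε.pow_ne_one_of_pos_of_lt (by norm_num) (by norm_num)
  set Y : Fin 3 → K := ![linForm X U 0 0, linForm X U 0 1, linForm X χ 0 0] with hYdef
  have hYlin : LinearIndependent k Y := by
    refine linearIndependent_of_coeff hX.linearIndependent (c := ![fun g => (U g⁻¹).val 0 0,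
      fun g => (U g⁻¹).val 0 1, fun g => (χ g⁻¹).val 0 0]) ?_ ?_
    · intro i
      fin_cases i <;> rfl
    · intro a ha
      replace ha : ∀ g, a 0 * (U g).val 0 0 + a 1 * (U g).val 0 1 + a 2 * (χ g).val 0 0 = 0 := by
        intro g
        have := ha g⁻¹
        simpa only [Fin.sum_univ_three, Matrix.cons_val, inv_inv] using this
      have h1 := ha 1
      have hr := ha (PresentedGroup.of 2)
      have hl := ha (PresentedGroup.of 1)
      rw [hUr, hχr] at hr
      rw [hUa, hχa] at hl
      simp at h1 hr hl
      have h0 : a 0 = 0 := by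
        have : a 0 * (ε ^ 2 - 1) = 0 := by linear_combination hr - h1
        exact (mul_eq_zero.1 this).resolve_right (sub_ne_zero.2 hε2)
      have h02 : a 2 = 0 := by linear_combination h1 - h0
      have h01 : a 1 = 0 := by linear_combination hl - h02
      funext i
      fin_cases i
      · exact h0
      · exact h01
      · exact h02
  have hYX : ∀ i, Y i ∈ Submodule.span k (Set.range X) := by
    intro i
    fin_cases i <;> exact linForm_mem_span _ _ _ _
  have hYind := algebraicIndependent_of_linearForms hX htop hYlin hYX
  have hact : ∀ g, σ g (Y 0) = (U g).val 0 0 • Y 0 + (U g).val 1 0 • Y 1 ∧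
      σ g (Y 1) = (U g).val 0 1 • Y 0 + (U g).val 1 1 • Y 1 ∧
      σ g (Y 2) = (χ g).val 0 0 • Y 2 := by
    intro g
    simp [hYdef, map_linForm hσ, Fin.sum_univ_two]
  have hmem : ∀ i, Y i ∈ IntermediateField.adjoin k (Set.range Y) := fun i =>
    IntermediateField.subset_adjoin _ _ ⟨i, rfl⟩
  have hstab : ∀ g i, σ g (Y i) ∈ IntermediateField.adjoin k (Set.range Y) := by
    intro g i
    obtain ⟨e0, e1, e2⟩ := hact g
    fin_cases i
    · change σ g (Y 0) ∈ _
      rw [e0]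
      exact add_mem (IntermediateField.smul_mem _ (hmem 0)) (IntermediateField.smul_mem _ (hmem 1))
    · change σ g (Y 1) ∈ _
      rw [e1]
      exact add_mem (IntermediateField.smul_mem _ (hmem 0)) (IntermediateField.smul_mem _ (hmem 1))
    · change σ g (Y 2) ∈ _
      rw [e2]
      exact IntermediateField.smul_mem _ (hmem 2)
  have hsurj := (relationsOne_groupOne l).surjective (closure_groupOne l)
  have hχpow : ∀ (j b i : ℕ), (χ (PresentedGroup.of 2 ^ j * PresentedGroup.of 1 ^ b *
      PresentedGroup.of 0 ^ i)).val 0 0 = ζ ^ i := by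
    intro j b i
    rw [map_mul, map_mul, map_pow, map_pow, map_pow, hχa, hχr, one_pow, one_pow, one_mul, one_mul,
      Units.val_pow_eq_pow_val, hχt, ← map_pow]
    simp
  have hfaith : ∀ g, (∀ i, σ g (Y i) = Y i) → g = 1 := by
    intro g hg
    obtain ⟨e0, e1, e2⟩ := hact g
    rw [hg] at e0 e1 e2
    have hY := Fintype.linearIndependent_iff.1 hYlin
    have l0 := hY ![(U g).val 0 0 - 1, (U g).val 1 0, 0] (by
      simp only [Fin.sum_univ_three, Matrix.cons_val, sub_smul, one_smul, zero_smul]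
      linear_combination -e0)
    have l1 := hY ![(U g).val 0 1, (U g).val 1 1 - 1, 0] (by
      simp only [Fin.sum_univ_three, Matrix.cons_val, sub_smul, one_smul, zero_smul]
      linear_combination -e1)
    have l2 := hY ![0, 0, (χ g).val 0 0 - 1] (by
      simp only [Fin.sum_univ_three, Matrix.cons_val, sub_smul, one_smul, zero_smul]
      linear_combination -e2)
    have hU : U g = 1 := by
      ext p q
      fin_cases p <;> fin_cases q
      · simpa using sub_eq_zero.1 (l0 0)
      · simpa using l1 0
      · simpa using l0 1
      · simpa using sub_eq_zero.1 (l1 1)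
    have hχ : (χ g).val 0 0 = 1 := sub_eq_zero.1 (l2 2)
    -- `χ` kills λ and ρ and so detects the power of τ; `U` then detects the rest.
    obtain ⟨⟨j, b, i⟩, rfl⟩ := hsurj g
    dsimp only at hχ hU ⊢
    rw [hχpow] at hχ
    have hi : (i : ℕ) = 0 := by
      refine hζ.pow_inj i.is_lt (by positivity) ?_
      rw [hχ, pow_zero]
    rw [hi, pow_zero, mul_one] at hU ⊢
    rw [map_mul, map_pow, map_pow] at hU
    obtain ⟨rfl, rfl⟩ := quaternion_pow_injective hε hUa hUr (j' := 0) (b' := 0)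
      (by simpa using hU)
    simp
  -- Only a lower bound for the order is needed; the representations supply it by separating the
  -- 4·2·3^l normal forms.
  have hcard : 12 * 2 * 3 ^ (l - 1) ≤ Nat.card (GroupOne l) := by
    have hinj : Function.Injective fun p : Fin 4 × Fin 2 × Fin (3 ^ l) =>
        (PresentedGroup.of 2 ^ (p.1 : ℕ) * PresentedGroup.of 1 ^ (p.2.1 : ℕ) *
          PresentedGroup.of 0 ^ (p.2.2 : ℕ) : GroupOne l) := by
      rintro ⟨j, b, i⟩ ⟨j', b', i'⟩ h
      dsimp only at h
      have h1 := congrArg (fun g => (χ g).val 0 0) h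
      simp only [hχpow] at h1
      obtain rfl : i = i' := Fin.ext (hζ.pow_inj i.is_lt i'.is_lt h1)
      have h3 := congrArg U (mul_right_cancel h)
      rw [map_mul, map_mul, map_pow, map_pow, map_pow, map_pow] at h3
      obtain ⟨rfl, rfl⟩ := quaternion_pow_injective hε hUa hUr h3
      rfl
    have := Nat.card_le_card_of_injective _ hinj
    simp only [Nat.card_prod, Nat.card_fin] at this
    have h3 : 3 ^ l = 3 ^ (l - 1) * 3 := by rw [← pow_succ, Nat.sub_add_cancel hl]
    omega
  set w := algebraMap k K ω with hw
  have hw3 : w ^ 3 = 1 := by rw [hw, ← map_pow, hω3, map_one]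
  have hw1 : w ^ 2 + w + 1 = 0 := by
    rw [hw, ← map_pow, ← map_add, ← map_one (algebraMap k K), ← map_add, hω, map_zero]
  have hw2 : (w ^ 2) ^ 2 + w ^ 2 + 1 = 0 := by linear_combination hw1 + w * hw3
  set e := algebraMap k K ε with he
  have hi : (e ^ 2) ^ 2 = -1 := by
    rw [he, ← map_pow, ← map_pow, ← pow_mul, h4, map_neg, map_one]
  have h2K : (2 : K) ≠ 0 := by
    rw [← map_ofNat (algebraMap k K) 2]
    exact (map_ne_zero _).2 h2
  have hinv : ∀ g i, σ g (invariantsOne w (3 ^ (l - 1)) (Y 0) (Y 1) (Y 2) i) =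
      invariantsOne w (3 ^ (l - 1)) (Y 0) (Y 1) (Y 2) i := by
    intro g i
    refine map_eq_of_closure_eq_top (closure_groupOne l) ?_ g
    intro s hs
    rw [show ∀ z, σ s z = (σ s : K →+* K) z from fun _ => rfl, map_invariantsOne]
    simp only [RingHom.coe_coe, hw, AlgEquiv.commutes]
    obtain ⟨e0, e1, e2⟩ := hact s
    refine congrFun ?_ i
    rcases hs with rfl | rfl | rfl
    · have a0 : σ (PresentedGroup.of 0) (Y 0) =
          -(1 + e ^ 2) / 2 * Y 0 + (1 + e ^ 2) / 2 * Y 1 := by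
        rw [e0, hUt]
        simp [Algebra.smul_def, he, map_ofNat (algebraMap k K) 2]
      have a1 : σ (PresentedGroup.of 0) (Y 1) =
          (e ^ 2 - 1) / 2 * Y 0 + (e ^ 2 - 1) / 2 * Y 1 := by
        rw [e1, hUt]
        simp [Algebra.smul_def, he, map_ofNat (algebraMap k K) 2]
      rw [a0, a1]
      refine invariantsOne_tau hw3 (tetraForm_tau h2K hi hw1 _ _) (tetraForm_tau h2K hi hw2 _ _)
        (octaForm_tau h2K hi _ _) ?_
      rw [e2, hχt]
      simp [Algebra.smul_def, mul_pow, ← map_pow, hζω]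
    · have a0 : σ (PresentedGroup.of 1) (Y 0) = -Y 1 := by
        rw [e0, hUa]
        simp
      have a1 : σ (PresentedGroup.of 1) (Y 1) = Y 0 := by
        rw [e1, hUa]
        simp
      have a2 : σ (PresentedGroup.of 1) (Y 2) = Y 2 := by
        rw [e2, hχa]
        simp
      rw [a0, a1, a2]
      exact invariantsOne_congr (tetraForm_lambda _ _ _) (tetraForm_lambda _ _ _)
        (octaForm_lambda _ _)
    · have a0 : σ (PresentedGroup.of 2) (Y 0) = e ^ 2 * Y 0 := by
        rw [e0, hUr]
        simp [Algebra.smul_def, he]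
      have a1 : σ (PresentedGroup.of 2) (Y 1) = -e ^ 2 * Y 1 := by
        rw [e1, hUr]
        simp [Algebra.smul_def, he]
      have a2 : σ (PresentedGroup.of 2) (Y 2) = Y 2 := by
        rw [e2, hχr]
        simp
      rw [a0, a1, a2]
      exact invariantsOne_congr (tetraForm_rho hi _ _ _) (tetraForm_rho hi _ _ _)
        (octaForm_rho hi _ _)
  refine isRationalExtension_fixedField hX htop hσ hYlin hYX hstab hfaith hinv ?_
  intro E hE
  have hne : ∀ (p : MvPolynomial (Fin 3) k) (a : Fin 3 → k), MvPolynomial.eval a p ≠ 0 →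
      MvPolynomial.aeval Y p ≠ 0 := aeval_ne_zero_of_eval_ne_zero hYind
  have hΦ : ∀ ω : k, tetraForm (algebraMap k K ω) (Y 0) (Y 1) ≠ 0 := by
    intro ω
    simpa [tetraForm] using hne (tetraForm (MvPolynomial.C ω) (MvPolynomial.X 0) (MvPolynomial.X 1))
      ![1, 0, 0] (by simp [tetraForm])
  have hY0 : Y 0 ≠ 0 := hYlin.ne_zero 0
  have hY1 : Y 1 ≠ 0 := hYlin.ne_zero 1
  have hf : octaForm (Y 0) (Y 1) ≠ 0 := by
    refine mul_ne_zero (mul_ne_zero hY0 hY1) ?_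
    have h := hne (MvPolynomial.X 0 ^ 4 - MvPolynomial.X 1 ^ 4) ![1, 0, 0] (by simp)
    rwa [map_sub, map_pow, map_pow, MvPolynomial.aeval_X, MvPolynomial.aeval_X] at h
  obtain ⟨F, hEF, ⟨h0, h1, h2⟩, hr⟩ := exists_field_of_invariantsOne_mem (ω := ω) (by positivity)
    hY1 (hΦ ω) (by rw [← map_pow]; exact hΦ _) hf hE
  refine ⟨F, hEF, ?_, hr.trans (by exact_mod_cast hcard)⟩
  intro i
  fin_cases i
  · exact h0
  · exact h1
  · exact h2

open IntermediateField in
theorem isRationalExtension_groupTwo {K : Type*} [Field K] [Algebra k K] (hl : 1 ≤ l) {m : ℤ}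
    (hm : (3 ^ l : ℤ) ∣ m + 1) {ε ζ : k}
    (hε : IsPrimitiveRoot ε 8) (hζ : IsPrimitiveRoot ζ (3 ^ l)) {X : GroupTwo l m → K}
    (hX : AlgebraicIndependent k X) (htop : adjoin k (Set.range X) = ⊤)
    {σ : GroupTwo l m →* (K ≃ₐ[k] K)} (hσ : ∀ g h, σ g (X h) = X (g * h)) :
    IsRationalExtension k (fixedField σ.range) := by
  have hfin := finite_groupTwo hm
  have := Fintype.ofFinite (GroupTwo l m)
  obtain ⟨U, hUt, hUa, hUr, hUn⟩ := exists_quaternionRep hm hl hε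
  obtain ⟨D, hDt, hDa, hDr, hDn⟩ := exists_dihedralRep hm hζ.pow_eq_one
  obtain ⟨ω, hω, hω3, hζω⟩ := exists_cubeRoot hl hζ
  replace hDa : D (PresentedGroup.of 1) = 1 := Units.ext hDa
  replace hDr : D (PresentedGroup.of 2) = 1 := Units.ext hDr
  have h4 := hε.pow_four_eq_neg_one
  have h2 := hε.two_ne_zero_of_eight
  have hε2 : ε ^ 2 ≠ 1 := hε.pow_ne_one_of_pos_of_lt (by norm_num) (by norm_num)
  set Y : Fin 4 → K := ![linForm X U 0 0, linForm X U 0 1, linForm X D 0 0, linForm X D 0 1]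
    with hYdef
  have hYlin : LinearIndependent k Y := by
    refine linearIndependent_of_coeff hX.linearIndependent (c := ![fun g => (U g⁻¹).val 0 0,
      fun g => (U g⁻¹).val 0 1, fun g => (D g⁻¹).val 0 0, fun g => (D g⁻¹).val 0 1]) ?_ ?_
    · intro i
      fin_cases i <;> rfl
    · intro a ha
      replace ha : ∀ g, a 0 * (U g).val 0 0 + a 1 * (U g).val 0 1 + a 2 * (D g).val 0 0 +
          a 3 * (D g).val 0 1 = 0 := by
        intro g
        have := ha g⁻¹
        simpa only [Fin.sum_univ_four, Matrix.cons_val, inv_inv] using this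
      have h1 := ha 1
      have hr := ha (PresentedGroup.of 2)
      have hl := ha (PresentedGroup.of 1)
      have hn := ha (PresentedGroup.of 3)
      rw [hUr, hDr] at hr
      rw [hUa, hDa] at hl
      rw [hUn, hDn] at hn
      simp at h1 hr hl hn
      have h0 : a 0 = 0 := by
        have : a 0 * (ε ^ 2 - 1) = 0 := by linear_combination hr - h1
        exact (mul_eq_zero.1 this).resolve_right (sub_ne_zero.2 hε2)
      have h02 : a 2 = 0 := by linear_combination h1 - h0
      have h01 : a 1 = 0 := by linear_combination hl - h02
      have h03 : a 3 = 0 := by linear_combination hn - ε * h01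
      funext i
      fin_cases i
      · exact h0
      · exact h01
      · exact h02
      · exact h03
  have hYX : ∀ i, Y i ∈ Submodule.span k (Set.range X) := by
    intro i
    fin_cases i <;> exact linForm_mem_span _ _ _ _
  have hYind := algebraicIndependent_of_linearForms hX htop hYlin hYX
  have hact : ∀ g, σ g (Y 0) = (U g).val 0 0 • Y 0 + (U g).val 1 0 • Y 1 ∧
      σ g (Y 1) = (U g).val 0 1 • Y 0 + (U g).val 1 1 • Y 1 ∧
      σ g (Y 2) = (D g).val 0 0 • Y 2 + (D g).val 1 0 • Y 3 ∧
      σ g (Y 3) = (D g).val 0 1 • Y 2 + (D g).val 1 1 • Y 3 := by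
    intro g
    simp [hYdef, map_linForm hσ, Fin.sum_univ_two]
  have hmem : ∀ i, Y i ∈ adjoin k (Set.range Y) := fun i => subset_adjoin _ _ ⟨i, rfl⟩
  have hstab : ∀ g i, σ g (Y i) ∈ adjoin k (Set.range Y) := by
    intro g i
    obtain ⟨e0, e1, e2, e3⟩ := hact g
    fin_cases i
    · change σ g (Y 0) ∈ _
      rw [e0]
      exact add_mem (IntermediateField.smul_mem _ (hmem 0)) (IntermediateField.smul_mem _ (hmem 1))
    · change σ g (Y 1) ∈ _
      rw [e1]
      exact add_mem (IntermediateField.smul_mem _ (hmem 0)) (IntermediateField.smul_mem _ (hmem 1))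
    · change σ g (Y 2) ∈ _
      rw [e2]
      exact add_mem (IntermediateField.smul_mem _ (hmem 2)) (IntermediateField.smul_mem _ (hmem 3))
    · change σ g (Y 3) ∈ _
      rw [e3]
      exact add_mem (IntermediateField.smul_mem _ (hmem 2)) (IntermediateField.smul_mem _ (hmem 3))
  have hsurj := RelationsTwo.surjective (relationsOne_groupTwo l m) (relationsTwo_groupTwo l m) hm
    (closure_groupTwo l m)
  have hDpow : ∀ (j b i c : ℕ), D (PresentedGroup.of 2 ^ j * PresentedGroup.of 1 ^ b *
      PresentedGroup.of 0 ^ i * PresentedGroup.of 3 ^ c) =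
      D (PresentedGroup.of 0) ^ i * D (PresentedGroup.of 3) ^ c := by
    intro j b i c
    rw [map_mul, map_mul, map_mul, map_pow, map_pow, map_pow, map_pow, hDa, hDr, one_pow, one_pow,
      one_mul, one_mul]
  have hfaith : ∀ g, (∀ i, σ g (Y i) = Y i) → g = 1 := by
    intro g hg
    obtain ⟨e0, e1, e2, e3⟩ := hact g
    rw [hg] at e0 e1 e2 e3
    have hY := Fintype.linearIndependent_iff.1 hYlin
    have l0 := hY ![(U g).val 0 0 - 1, (U g).val 1 0, 0, 0] (by
      simp only [Fin.sum_univ_four, Matrix.cons_val, sub_smul, one_smul, zero_smul]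
      linear_combination -e0)
    have l1 := hY ![(U g).val 0 1, (U g).val 1 1 - 1, 0, 0] (by
      simp only [Fin.sum_univ_four, Matrix.cons_val, sub_smul, one_smul, zero_smul]
      linear_combination -e1)
    have l2 := hY ![0, 0, (D g).val 0 0 - 1, (D g).val 1 0] (by
      simp only [Fin.sum_univ_four, Matrix.cons_val, sub_smul, one_smul, zero_smul]
      linear_combination -e2)
    have l3 := hY ![0, 0, (D g).val 0 1, (D g).val 1 1 - 1] (by
      simp only [Fin.sum_univ_four, Matrix.cons_val, sub_smul, one_smul, zero_smul]
      linear_combination -e3)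
    have hU : U g = 1 := by
      ext p q
      fin_cases p <;> fin_cases q
      · simpa using sub_eq_zero.1 (l0 0)
      · simpa using l1 0
      · simpa using l0 1
      · simpa using sub_eq_zero.1 (l1 1)
    have hD : D g = 1 := by
      ext p q
      fin_cases p <;> fin_cases q
      · simpa using sub_eq_zero.1 (l2 2)
      · simpa using l3 2
      · simpa using l2 3
      · simpa using sub_eq_zero.1 (l3 3)
    obtain ⟨⟨j, b, i, c⟩, rfl⟩ := hsurj g
    dsimp only at hD hU ⊢
    rw [hDpow] at hD
    obtain ⟨rfl, rfl⟩ := dihedral_pow_injective hζ hDt hDn (i' := ⟨0, by positivity⟩) (c' := 0)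
      (by simpa using hD)
    simp only [Fin.val_zero, pow_zero, mul_one] at hU ⊢
    rw [map_mul, map_pow, map_pow] at hU
    obtain ⟨rfl, rfl⟩ := quaternion_pow_injective hε hUa hUr (j' := 0) (b' := 0)
      (by simpa using hU)
    simp
  have h3l : 3 ^ l = 3 ^ (l - 1) * 3 := by rw [← pow_succ, Nat.sub_add_cancel hl]
  have hcard : 24 * 3 ^ (l - 1) * 2 ≤ Nat.card (GroupTwo l m) := by
    have hinj : Function.Injective fun p : Fin 4 × Fin 2 × Fin (3 ^ l) × Fin 2 =>
        (PresentedGroup.of 2 ^ (p.1 : ℕ) * PresentedGroup.of 1 ^ (p.2.1 : ℕ) *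
          PresentedGroup.of 0 ^ (p.2.2.1 : ℕ) * PresentedGroup.of 3 ^ (p.2.2.2 : ℕ) :
            GroupTwo l m) := by
      rintro ⟨j, b, i, c⟩ ⟨j', b', i', c'⟩ h
      dsimp only at h
      have h1 := congrArg D h
      rw [hDpow, hDpow] at h1
      obtain ⟨rfl, rfl⟩ := dihedral_pow_injective hζ hDt hDn h1
      have h3 := congrArg U (mul_right_cancel (mul_right_cancel h))
      rw [map_mul, map_mul, map_pow, map_pow, map_pow, map_pow] at h3
      obtain ⟨rfl, rfl⟩ := quaternion_pow_injective hε hUa hUr h3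
      rfl
    have := Nat.card_le_card_of_injective _ hinj
    simp only [Nat.card_prod, Nat.card_fin] at this
    omega
  set w := algebraMap k K ω with hw
  have hw3 : w ^ 3 = 1 := by rw [hw, ← map_pow, hω3, map_one]
  have hw1 : w ^ 2 + w + 1 = 0 := by
    rw [hw, ← map_pow, ← map_add, ← map_one (algebraMap k K), ← map_add, hω, map_zero]
  have hw2 : (w ^ 2) ^ 2 + w ^ 2 + 1 = 0 := by linear_combination hw1 + w * hw3
  set e := algebraMap k K ε with he
  have he4 : e ^ 4 = -1 := by
    rw [he, ← map_pow, h4, map_neg, map_one]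
  have hi : (e ^ 2) ^ 2 = -1 := by
    rw [← pow_mul, he4]
  have h2K : (2 : K) ≠ 0 := by
    rw [← map_ofNat (algebraMap k K) 2]
    exact (map_ne_zero _).2 h2
  -- This `j` makes τ multiply u^(j+1)/v^j by ζ^(3^l) = 1.
  obtain ⟨j, hj⟩ : ∃ j, 2 * j + 1 = 3 ^ l := by
    obtain ⟨j, hj⟩ := (Odd.pow (by decide : Odd 3) : Odd (3 ^ l))
    exact ⟨j, hj.symm⟩
  have hinv : ∀ g i, σ g (invariantsTwo w (3 ^ (l - 1)) j (Y 0) (Y 1) (Y 2) (Y 3) i) =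
      invariantsTwo w (3 ^ (l - 1)) j (Y 0) (Y 1) (Y 2) (Y 3) i := by
    intro g i
    refine map_eq_of_closure_eq_top (closure_groupTwo l m) ?_ g
    intro s hs
    rw [show ∀ z, σ s z = (σ s : K →+* K) z from fun _ => rfl, map_invariantsTwo]
    simp only [RingHom.coe_coe, hw, AlgEquiv.commutes]
    obtain ⟨e0, e1, e2, e3⟩ := hact s
    refine congrFun ?_ i
    rcases hs with rfl | rfl | rfl | rfl
    · have a0 : σ (PresentedGroup.of 0) (Y 0) =
          -(1 + e ^ 2) / 2 * Y 0 + (1 + e ^ 2) / 2 * Y 1 := by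
        rw [e0, hUt]
        simp [Algebra.smul_def, he, map_ofNat (algebraMap k K) 2]
      have a1 : σ (PresentedGroup.of 0) (Y 1) =
          (e ^ 2 - 1) / 2 * Y 0 + (e ^ 2 - 1) / 2 * Y 1 := by
        rw [e1, hUt]
        simp [Algebra.smul_def, he, map_ofNat (algebraMap k K) 2]
      have a2 : σ (PresentedGroup.of 0) (Y 2) = algebraMap k K ζ * Y 2 := by
        rw [e2, hDt]
        simp [Algebra.smul_def]
      have a3 : σ (PresentedGroup.of 0) (Y 3) = (algebraMap k K ζ)⁻¹ * Y 3 := by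
        rw [e3, hDt]
        simp [Algebra.smul_def]
      rw [a0, a1, a2, a3]
      refine invariantsTwo_tau hw3 (tetraForm_tau h2K hi hw1 _ _) (tetraForm_tau h2K hi hw2 _ _)
        (octaForm_tau h2K hi _ _) ?_ ?_
      · rw [hj, ← map_pow, hζ.pow_eq_one, map_one]
      · rw [← map_pow, hζω]
    · have a0 : σ (PresentedGroup.of 1) (Y 0) = -Y 1 := by
        rw [e0, hUa]
        simp
      have a1 : σ (PresentedGroup.of 1) (Y 1) = Y 0 := by
        rw [e1, hUa]
        simp
      have a2 : σ (PresentedGroup.of 1) (Y 2) = Y 2 := by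
        rw [e2, hDa]
        simp
      have a3 : σ (PresentedGroup.of 1) (Y 3) = Y 3 := by
        rw [e3, hDa]
        simp
      rw [a0, a1, a2, a3]
      exact invariantsTwo_congr (tetraForm_lambda _ _ _) (tetraForm_lambda _ _ _)
        (octaForm_lambda _ _)
    · have a0 : σ (PresentedGroup.of 2) (Y 0) = e ^ 2 * Y 0 := by
        rw [e0, hUr]
        simp [Algebra.smul_def, he]
      have a1 : σ (PresentedGroup.of 2) (Y 1) = -e ^ 2 * Y 1 := by
        rw [e1, hUr]
        simp [Algebra.smul_def, he]
      have a2 : σ (PresentedGroup.of 2) (Y 2) = Y 2 := by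
        rw [e2, hDr]
        simp
      have a3 : σ (PresentedGroup.of 2) (Y 3) = Y 3 := by
        rw [e3, hDr]
        simp
      rw [a0, a1, a2, a3]
      exact invariantsTwo_congr (tetraForm_rho hi _ _ _) (tetraForm_rho hi _ _ _)
        (octaForm_rho hi _ _)
    · have a0 : σ (PresentedGroup.of 3) (Y 0) = e ^ 3 * Y 1 := by
        rw [e0, hUn]
        simp [Algebra.smul_def, he]
      have a1 : σ (PresentedGroup.of 3) (Y 1) = e * Y 0 := by
        rw [e1, hUn]
        simp [Algebra.smul_def, he]
      have a2 : σ (PresentedGroup.of 3) (Y 2) = Y 3 := by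
        rw [e2, hDn]
        simp
      have a3 : σ (PresentedGroup.of 3) (Y 3) = Y 2 := by
        rw [e3, hDn]
        simp
      rw [a0, a1, a2, a3]
      exact invariantsTwo_nu (tetraForm_nu he4 (by linear_combination hw1) _ _)
        (tetraForm_nu he4 (by linear_combination hw1) _ _) (octaForm_nu he4 _ _)
  refine isRationalExtension_fixedField hX htop hσ hYlin hYX hstab hfaith hinv ?_
  intro E hE
  have hne : ∀ (p : MvPolynomial (Fin 4) k) (a : Fin 4 → k), MvPolynomial.eval a p ≠ 0 →
      MvPolynomial.aeval Y p ≠ 0 := aeval_ne_zero_of_eval_ne_zero hYind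
  have haeval : ∀ ω : k, MvPolynomial.aeval Y
      (tetraForm (MvPolynomial.C ω) (MvPolynomial.X 0) (MvPolynomial.X 1)) =
      tetraForm (algebraMap k K ω) (Y 0) (Y 1) := by
    intro ω
    simp [tetraForm]
  have hΦ : ∀ ω : k, tetraForm (algebraMap k K ω) (Y 0) (Y 1) ≠ 0 := by
    intro ω
    rw [← haeval]
    exact hne _ ![1, 0, 0, 0] (by simp [tetraForm])
  have hY0 : Y 0 ≠ 0 := hYlin.ne_zero 0
  have hY1 : Y 1 ≠ 0 := hYlin.ne_zero 1
  have hf : octaForm (Y 0) (Y 1) ≠ 0 := by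
    refine mul_ne_zero (mul_ne_zero hY0 hY1) ?_
    have h := hne (MvPolynomial.X 0 ^ 4 - MvPolynomial.X 1 ^ 4) ![1, 0, 0, 0] (by simp)
    rwa [map_sub, map_pow, map_pow, MvPolynomial.aeval_X, MvPolynomial.aeval_X] at h
  have hsum : tetraForm w (Y 0) (Y 1) ^ 3 + tetraForm (w ^ 2) (Y 0) (Y 1) ^ 3 ≠ 0 := by
    rw [hw, ← map_pow, ← haeval, ← haeval, ← map_pow, ← map_pow, ← map_add]
    -- At x = 1, y = 0 both forms equal 1, so the sum of cubes is 2.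
    exact hne _ ![1, 0, 0, 0] (by simpa [tetraForm, one_add_one_eq_two] using h2)
  have hsub : tetraForm w (Y 0) (Y 1) ^ 2 * Y 2 ^ 3 ^ (l - 1) -
      tetraForm (w ^ 2) (Y 0) (Y 1) ^ 2 * Y 3 ^ 3 ^ (l - 1) ≠ 0 := by
    rw [hw, ← map_pow, ← haeval, ← haeval, ← MvPolynomial.aeval_X (R := k) Y 2,
      ← MvPolynomial.aeval_X (R := k) Y 3, ← map_pow, ← map_pow, ← map_pow, ← map_pow, ← map_mul,
      ← map_mul, ← map_sub]
    exact hne _ ![1, 0, 1, 0] (by simp [tetraForm])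
  have huv : Y 2 ^ (2 * j + 1) + Y 3 ^ (2 * j + 1) ≠ 0 := by
    rw [← MvPolynomial.aeval_X (R := k) Y 2, ← MvPolynomial.aeval_X (R := k) Y 3, ← map_pow,
      ← map_pow, ← map_add]
    exact hne _ ![0, 0, 1, 0] (by simp)
  obtain ⟨F, hEF, ⟨h0, h1, h2, h3⟩, hr⟩ := exists_field_of_invariantsTwo_mem hω h2K
    (by positivity) hY1 (hYlin.ne_zero 2) (hYlin.ne_zero 3) (hΦ ω)
    (by rw [← map_pow]; exact hΦ _) hf hsum hsub huv hE
  refine ⟨F, hEF, ?_, hr.trans (by exact_mod_cast hcard)⟩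
  intro i
  fin_cases i
  · exact h0
  · exact h1
  · exact h2
  · exact h3

end Rationality

theorem mainTheorem8 (l : ℕ) (hl : 1 ≤ l) (m : ℤ)
    (hm : m + 1 ≡ 0 [ZMOD 3]) (hm' : m ^ 2 ≡ 1 [ZMOD 3 ^ l])
    (k : Type*) [Field k]
    (hk : ∃ ζ : k, IsPrimitiveRoot ζ (Monoid.exponent (GroupTwo l m))) :
    IsRationalExtension k (noetherField k (GroupOne l)) ∧
      IsRationalExtension k (noetherField k (GroupTwo l m)) := by
  obtain ⟨ξ, hξ⟩ := hk
  have hdvd := three_pow_dvd_add_one hm hm'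
  obtain ⟨⟨ε, hε⟩, ⟨ζ, hζ⟩⟩ := exists_primitiveRoots hl hdvd hξ
  exact ⟨isRationalExtension_groupOne hl hε hζ (algebraicIndependent_algebraMap_X k _)
      (adjoin_range_algebraMap_X k _) (noetherAction_X k _),
    isRationalExtension_groupTwo hl hdvd hε hζ (algebraicIndependent_algebraMap_X k _)
      (adjoin_range_algebraMap_X k _) (noetherAction_X k _)⟩
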